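/- **Definitions.** A sequence is a *Davenport–Schinzel sequence of order $s$* if it has no two adjacent equal symbols and does not contain, for any two symbols $a\ne b$, an alternation $a\,b\,a\,b\cdots$ of length $s+2$ as a (not necessarily contiguous) subsequence. $\lambda_s(n)$ is the maximum length of such a sequence on $n$ distinct symbols. $|S|$ is the length of a sequence $S$ and $\|S\|$ its number of distinct symbols. Let $A_1(n)=2n$, let $A_k(n)=A_{k-1}^{(n)}(1)$ ($n$-fold iteration) for $k\ge2$, and let $\alpha(x)=\min\{n\ge1 : A_n(3)\ge x\}$. For even $s\ge2$ and $k\ge0$ let $\mu_2(k)=2$, let $\mu_s(0)=1$ for $s\ge4$, and let $\mu_s(k)=\mu_{s-2}(k-1)\,\mu_s(k-1)$ for $s\ge4$, $k\ge1$. **Construction.** For $s\ge2$ even, $k\ge0$, $m\ge1$, define a sequence $S^s_k(m)$, divided into blocks of length $m$, as follows. - $S^2_k(m)$ consists of the two blocks $12\ldots m$ and $m\ldots21$. - For $s\ge4$, $S^s_0(m)$ is the single block $12\ldots m$. - For $s\ge4$, $k\ge1$, $S^s_k(1)$ consists of $\mu_s(k)$ blocks, each consisting of the single symbol $1$. - For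 $s\ge4$, $k\ge1$, $m\ge2$, let $S'=S^s_k(m-1)$, let $f$ be the number of its blocks, let $\overline S=S^{s-2}_{k-1}(f)$, let $g=\|\overline S\|$ and $S^*=S^s_{k-1}(g)$. Replace each block of $S^*$ by a copy of $\overline S$ on the same $g$ symbols, making their first appearances in the same order as in the replaced block; call the result $\widehat S^*$, with $h$ blocks, each of length $f$. Concatenate $h$ copies of $S'$ whose symbols are fresh (pairwise disjoint and disjoint from the symbols of $\widehat S^*$), and insert the symbols of $\widehat S^*$, in order, one at the end of each of the $fh$ blocks. The result is $S^s_k(m)$. **Statement.** Let $s\ge4$ be even and $t=s/2-1$. 1. For all $k\ge0$, $m\ge1$, the sequence $S^s_k(m)$ is a nonempty concatenation of blocks of length $m$, each block consisting of $m$ distinct symbols; it contains no alternation $abab\cdots$ of length $s+2$ with $a\ne b$; each symbol makes all its appearances in the same position within the blocks; and no two distinct symbols appear together in more than one block. 2. For all $k\ge0$, $m\ge2$, $S^s_k(m)$ is a Davenport–Schinzel sequence of order $s$. 3. For all $k\ge0$, $m\ge1$, every symbol occurring in $S^s_k(m)$ occurs in it exactly $\mu_s(k)$ times, and $\mu_s(k)=2^{\binom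 kt}$. 4. There is a constant $C$, depending only on $s$, such that, for all $k\ge0$, the sequence $T_k=S^s_k(2)$ with $n_k=\|T_k\|$ satisfies $$|T_k|\ \ge\ n_k\cdot 2^{\frac1{t!}\alpha(n_k)^t-C\,\alpha(n_k)^{t-1}},$$ and, for all $n\ge1$, $$\lambda_s(n)\ \ge\ n\cdot 2^{\frac1{t!}\alpha(n)^t-C\,\alpha(n)^{t-1}}.$$ -/

import Mathlib

open scoped Nat

namespace EvenDS

/-! ### Davenport–Schinzel sequences and `λ_s(n)` -/

/-- The alternation `a b a b …` of length `ℓ`. -/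
def alternation (a b : ℕ) : ℕ → List ℕ
  | 0 => []
  | ℓ + 1 => a :: alternation b a ℓ

/-- Number `‖S‖` of distinct symbols of a sequence. -/
def numSymbols (S : List ℕ) : ℕ := S.toFinset.card

/-- No alternation `a b a b …` of length `ℓ` with `a ≠ b` is a (not necessarily contiguous)
subsequence of `S`. -/
def AvoidsAlternation (ℓ : ℕ) (S : List ℕ) : Prop :=
  ∀ a b : ℕ, a ≠ b → ¬ (alternation a b ℓ).Sublist S

/-- Davenport–Schinzel sequence of order `s`: no adjacent repeated symbols and no alternation
of length `s + 2`. -/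
def IsDavenportSchinzel (s : ℕ) (S : List ℕ) : Prop :=
  S.IsChain (· ≠ ·) ∧ AvoidsAlternation (s + 2) S

/-- Lengths of the Davenport–Schinzel sequences of order `s` on exactly `n` distinct symbols. -/
def dsLengths (s n : ℕ) : Set ℕ :=
  {ℓ | ∃ S : List ℕ, IsDavenportSchinzel s S ∧ numSymbols S = n ∧ S.length = ℓ}

/-- `λ_s(n)`: the maximum length of a Davenport–Schinzel sequence of order `s` on `n` distinct
symbols (a genuine maximum for `s ≥ 1`, see `isGreatest_lambda`). -/
noncomputable def lambda (s n : ℕ) : ℕ := sSup (dsLengths s n)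

theorem alternation_sublist_of_le {a b ℓ : ℕ} :
    ∀ {ℓ' : ℕ}, ℓ ≤ ℓ' → (alternation a b ℓ).Sublist (alternation a b ℓ') := by
  induction ℓ generalizing a b with
  | zero => intro ℓ' _; exact List.nil_sublist _
  | succ ℓ ih =>
    intro ℓ' h
    obtain ⟨j, rfl⟩ : ∃ j, ℓ' = j + 1 := ⟨ℓ' - 1, by omega⟩
    exact (ih (by omega)).cons_cons a

theorem alternation_sublist_of_count {a b : ℕ} (hab : a ≠ b) :
    ∀ S : List ℕ, (alternation a b (2 * (S.zip S.tail).count (a, b))).Sublist S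
  | [] => by simp [alternation]
  | [x] => by simp [alternation]
  | x :: y :: T => by
    have h1 := alternation_sublist_of_count hab (y :: T)
    have h2 := alternation_sublist_of_count hab T
    by_cases hxy : x = a ∧ y = b
    · obtain ⟨rfl, rfl⟩ := hxy
      have h3 : ((y :: T).zip T).count (x, y) = (T.zip T.tail).count (x, y) := by
        cases T with
        | nil => simp
        | cons z T => simp [hab.symm]
      have h4 : ((x :: y :: T).zip (x :: y :: T).tail).count (x, y)
          = (T.zip T.tail).count (x, y) + 1 := by
        simp [h3]
      rw [h4, Nat.mul_add]
      exact (h2.cons_cons y).cons_cons x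
    · have h4 : ((x :: y :: T).zip (x :: y :: T).tail).count (a, b)
          = ((y :: T).zip (y :: T).tail).count (a, b) := by
        simp [hxy]
      rw [h4]
      exact h1.cons x
  termination_by S => S.length

theorem ne_of_mem_zip_tail {a b : ℕ} :
    ∀ S : List ℕ, S.IsChain (· ≠ ·) → (a, b) ∈ S.zip S.tail → a ≠ b
  | [], _, h => by simp at h
  | [x], _, h => by simp at h
  | x :: y :: T, hc, h => by
    rw [List.isChain_cons_cons] at hc
    rw [List.tail_cons, List.zip_cons_cons, List.mem_cons] at h
    rcases h with h | h
    · rw [Prod.mk.injEq] at h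
      rw [h.1, h.2]; exact hc.1
    · exact ne_of_mem_zip_tail (y :: T) hc.2 h

theorem length_le_of_isDavenportSchinzel {s : ℕ} {S : List ℕ} (h : IsDavenportSchinzel s S) :
    S.length ≤ numSymbols S * numSymbols S * (s + 1) + 1 := by
  have h1 : (S.zip S.tail).toFinset ⊆ S.toFinset ×ˢ S.toFinset := by
    rintro ⟨a, b⟩ hp
    have := List.of_mem_zip (List.mem_toFinset.1 hp)
    simp only [Finset.mem_product, List.mem_toFinset]
    exact ⟨this.1, List.mem_of_mem_tail this.2⟩
  have h2 : (S.zip S.tail).length ≤ numSymbols S * numSymbols S * (s + 1) := by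
    rw [← List.sum_toFinset_count_eq_length]
    calc _ ≤ ∑ _p ∈ (S.zip S.tail).toFinset, (s + 1) := by
          apply Finset.sum_le_sum
          rintro ⟨a, b⟩ hp
          have hab := ne_of_mem_zip_tail S h.1 (List.mem_toFinset.1 hp)
          by_contra hlt
          refine h.2 a b hab ((alternation_sublist_of_le ?_).trans
            (alternation_sublist_of_count hab S))
          have e : @List.count (ℕ × ℕ) instBEqOfDecidableEq (a, b) (S.zip S.tail)
              = (S.zip S.tail).count (a, b) := by
            congr
            exact lawful_beq_subsingleton _ _
          omega
      _ = (S.zip S.tail).toFinset.card * (s + 1) := by simp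
      _ ≤ _ := by
          rw [numSymbols, ← Finset.card_product]
          exact Nat.mul_le_mul_right _ (Finset.card_le_card h1)
  simp only [List.length_zip, List.length_tail] at h2
  omega

theorem alternation_not_sublist_range {a b n ℓ : ℕ} (hℓ : 3 ≤ ℓ) :
    ¬ (alternation a b ℓ).Sublist (List.range n) := by
  intro h
  have h1 := ((alternation_sublist_of_le hℓ).trans h).nodup List.nodup_range
  simp [alternation] at h1

/-- For `s ≥ 1` the supremum in the definition of `λ_s(n)` is attained. -/
theorem isGreatest_lambda {s n : ℕ} (hs : 1 ≤ s) : IsGreatest (dsLengths s n) (lambda s n) := by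
  have hb : BddAbove (dsLengths s n) := by
    refine ⟨n * n * (s + 1) + 1, ?_⟩
    rintro _ ⟨S, hS, rfl, rfl⟩
    exact length_le_of_isDavenportSchinzel hS
  have hne : (dsLengths s n).Nonempty := by
    refine ⟨n, List.range n, ⟨?_, fun a b _ => alternation_not_sublist_range (by omega)⟩, ?_, ?_⟩
    · exact List.Pairwise.isChain List.nodup_range
    · rw [numSymbols, List.toFinset_card_of_nodup List.nodup_range, List.length_range]
    · exact List.length_range
  exact ⟨Nat.sSup_mem hne hb, fun _ hx => le_csSup hb hx⟩

/-! ### The Ackermann hierarchy and the inverse Ackermann function -/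

/-- `A_1(n) = 2n` and `A_k(n) = A_{k-1}^{(n)}(1)` for `k ≥ 2`; the value at `k = 0` is never
used. -/
def ackHier : ℕ → ℕ → ℕ
  | 0 => fun _ => 0
  | 1 => fun n => 2 * n
  | k + 2 => fun n => (ackHier (k + 1))^[n] 1

/-- The Ackermann function `A(n) = A_n(3)`, `n ≥ 1`. -/
def ack (n : ℕ) : ℕ := ackHier n 3

/-- The inverse Ackermann function `α(x) = min {n ≥ 1 | A(n) ≥ x}`. -/
noncomputable def invAck (x : ℕ) : ℕ := sInf {n | 1 ≤ n ∧ x ≤ ack n}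

/-! ### The sequences `S^s_k(m)`

They are given as lists of blocks, the sequence itself being the concatenation of the blocks;
symbols are natural numbers. The index `s` is meant to be even and at least `2`, and `m ≥ 1`. -/

/-- `μ_s(k)`: `μ_2(k) = 2`, `μ_s(0) = 1` for `s ≥ 4`, and
`μ_s(k) = μ_{s-2}(k-1) μ_s(k-1)`. -/
def mu : ℕ → ℕ → ℕ
  | s, 0 => if s ≤ 2 then 2 else 1
  | s, k + 1 => if s ≤ 2 then 2 else mu (s - 2) k * mu s k

/-- The distinct symbols of a sequence in the order of their first appearances. -/
def firstAppearances (S : List ℕ) : List ℕ := S.reverse.dedup.reverse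

/-- A copy of the block sequence `Sbar` in which the `i`-th symbol, in the order of first
appearances, is renamed to the `i`-th symbol of `B`. -/
def copyOn (Sbar : List (List ℕ)) (B : List ℕ) : List (List ℕ) :=
  Sbar.map fun P => P.map fun x => B.getD ((firstAppearances Sbar.flatten).idxOf x) 0

/-- Replace every block of `Sstar` by a copy of `Sbar` on the symbols of that block. -/
def replaceBlocks (Sbar Sstar : List (List ℕ)) : List (List ℕ) :=
  Sstar.flatMap (copyOn Sbar)

/-- Take one copy of `S'` for each block of `Shat`, and append the symbols of the `j`-th block of
`Shat`, in order, at the ends of the blocks of the `j`-th copy of `S'`. The symbol `b` of the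
`j`-th copy of `S'` is renamed to `Nat.pair (j + 1) b` and the symbol `a` of `Shat` to
`Nat.pair 0 a`, so that all these sets of symbols are disjoint. -/
def distribute (S' Shat : List (List ℕ)) : List (List ℕ) :=
  (Shat.mapIdx fun j D =>
    List.zipWith (fun P a => P.map (Nat.pair (j + 1)) ++ [Nat.pair 0 a]) S' D).flatten

/-- The recursion on `m`, from `Slow m = S^{s-2}_{k-1}(m)`, `Sprev m = S^s_{k-1}(m)` and
`μ = μ_s(k)`. -/
def buildRow (μ : ℕ) (Slow Sprev : ℕ → List (List ℕ)) : ℕ → List (List ℕ)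
  | 0 => []
  | 1 => List.replicate μ [1]
  | m + 2 =>
    let S' := buildRow μ Slow Sprev (m + 1)
    let Sbar := Slow S'.length
    let Sstar := Sprev (numSymbols Sbar.flatten)
    distribute S' (replaceBlocks Sbar Sstar)

/-- The blocks of `S^s_k(m)`; the arguments are in the order `k`, `s`, `m`. -/
def blocksAux : ℕ → ℕ → ℕ → List (List ℕ)
  | 0, s, m =>
    if s ≤ 2 then [List.range' 1 m, (List.range' 1 m).reverse] else [List.range' 1 m]
  | k + 1, s, m =>
    if s ≤ 2 then [List.range' 1 m, (List.range' 1 m).reverse]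
    else buildRow (mu s (k + 1)) (blocksAux k (s - 2)) (blocksAux k s) m

/-- The blocks of `S^s_k(m)`. -/
def blocks (s k m : ℕ) : List (List ℕ) := blocksAux k s m

/-- The sequence `S^s_k(m)`. -/
def seq (s k m : ℕ) : List ℕ := (blocks s k m).flatten

end EvenDS

/-! For two symbols, `altLength a b` greedily computes the longest alternation starting with a. Over
a concatenation it splits, the parity of the first part telling which symbol is awaited in the
second (`altLength_append`), so all bounds on alternations become arithmetic with parities.

The induction carries more than the theorem states. By `IsPositional.outside`, two symbols sharing a
block in the order x, y look like y…y x…x before it and x…x y…y after it. Together with fixed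
positions this forces a pair to share at most one block (`IsPositional.not_mem_both`), so replacing
blocks affects a given pair in one place only. There the copy has order s-2 and shows x first; as s
is even, the two surrounding patterns raise the order by only two (`IsUniform.of_replaceBlocks`).
After distribution, symbols of the same origin alternate as before and symbols of different origins
at most like p q p q p; each appended symbol is last in its block, which restores the pattern
(`IsPositional.of_distribute`).

Multiplicities multiply, and the recursion for μ is Pascal's rule in the exponent (`mu_eq`). One
step in m costs at most eight applications of the preceding Ackermann level, so the number of blocks
is at most A_{k+3}(8m+8) (`length_blocks_le`) and α(n_k) ≤ k+5. Hence binom(k,t) is at least α^t/t!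
up to O(α^{t-1}) (`exponent_le_choose`). For arbitrary n, disjoint copies of a suitable T_k lose a
factor of at most two, which the lower-order term absorbs. -/

namespace EvenDS

/-! ### The longest alternation on two symbols -/

/-- Length of the longest alternation `a b a b …` that is a subsequence of a sequence. -/
def altLength (a b : ℕ) : List ℕ → ℕ
  | [] => 0
  | x :: S => if x = a then altLength b a S + 1 else altLength a b S

theorem altLength_cons (a b x : ℕ) (S : List ℕ) :
    altLength a b (x :: S) = if x = a then altLength b a S + 1 else altLength a b S := by
  rw [altLength]

theorem altLength_le_succ (a b : ℕ) (S : List ℕ) : altLength a b S ≤ altLength b a S + 1 := by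
  induction S generalizing a b with
  | nil => simp [altLength]
  | cons x S ih =>
    have h1 := ih a b
    have h2 := ih b a
    simp only [altLength]
    split_ifs with hab hb
    · subst hab; subst hb; omega
    all_goals omega

theorem alternation_sublist_iff {a b ℓ : ℕ} {S : List ℕ} :
    (alternation a b ℓ).Sublist S ↔ ℓ ≤ altLength a b S := by
  induction S generalizing a b ℓ with
  | nil => cases ℓ <;> simp [alternation, altLength]
  | cons x S ih =>
    cases ℓ with
    | zero => simp [alternation]
    | succ ℓ =>
      rw [altLength_cons]
      split_ifs with h
      · subst h
        rw [alternation, List.cons_sublist_cons, ih]; omega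
      · rw [← ih, alternation]
        constructor
        · intro h'
          cases h' with
          | cons _ h' => exact h'
          | cons_cons _ h' => exact absurd rfl h
        · exact fun h' => h'.cons x

theorem avoidsAlternation_iff {ℓ : ℕ} {S : List ℕ} :
    AvoidsAlternation (ℓ + 1) S ↔ ∀ a b, a ≠ b → altLength a b S ≤ ℓ := by
  simp only [AvoidsAlternation, alternation_sublist_iff, not_le, Nat.lt_succ_iff]

theorem pair_sublist_iff {a b : ℕ} {S : List ℕ} : [a, b].Sublist S ↔ 2 ≤ altLength a b S :=
  alternation_sublist_iff (a := a) (b := b) (ℓ := 2)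

/-- The greedy run through `S` awaits `a` again exactly when its length is even; otherwise it
continues in `T` with `b`. -/
theorem altLength_append (a b : ℕ) (S T : List ℕ) :
    altLength a b (S ++ T) = altLength a b S +
      if Even (altLength a b S) then altLength a b T else altLength b a T := by
  induction S generalizing a b with
  | nil => simp [altLength]
  | cons x S ih =>
    simp only [List.cons_append, altLength]
    split_ifs with h1 h2 h2
    · rw [ih]
      rw [Nat.even_add_one] at h2
      simp [h2]; omega
    · rw [ih]
      rw [Nat.even_add_one, not_not] at h2
      simp [h2]; omega
    · rw [ih]; simp [h2]
    · rw [ih]; simp [h2]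

theorem altLength_of_notMem_left {a b : ℕ} {S : List ℕ} (h : a ∉ S) : altLength a b S = 0 := by
  induction S with
  | nil => rfl
  | cons x S ih =>
    simp only [List.mem_cons, not_or] at h
    rw [altLength_cons, if_neg (Ne.symm h.1), ih h.2]

theorem altLength_of_notMem_right {a b : ℕ} {S : List ℕ} (h : b ∉ S) :
    altLength a b S = if a ∈ S then 1 else 0 := by
  induction S with
  | nil => rfl
  | cons x S ih =>
    simp only [List.mem_cons, not_or] at h
    rw [altLength_cons]
    by_cases hx : x = a
    · subst hx; simp [altLength_of_notMem_left h.2]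
    · rw [if_neg hx, ih h.2]; simp [Ne.symm hx]

theorem altLength_le_count (a b : ℕ) (S : List ℕ) :
    altLength a b S ≤ 2 * S.count a ∧ altLength b a S ≤ 2 * S.count a + 1 := by
  induction S with
  | nil => simp [altLength]
  | cons x S ih =>
    simp only [altLength, List.count_cons, beq_iff_eq]
    split_ifs <;> omega

theorem altLength_filter {a b : ℕ} {f : ℕ → Bool} (ha : f a) (hb : f b) (S : List ℕ) :
    altLength a b (S.filter f) = altLength a b S := by
  induction S generalizing a b with
  | nil => rfl
  | cons x S ih =>
    by_cases hx : f x
    · rw [List.filter_cons_of_pos hx, altLength_cons, altLength_cons, ih ha hb, ih hb ha]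
    · rw [List.filter_cons_of_neg hx, ih ha hb, altLength_cons, if_neg]
      rintro rfl; exact hx ha

theorem altLength_map {a b : ℕ} {f : ℕ → ℕ} {S : List ℕ} (ha : ∀ z ∈ S, f z = f a → z = a)
    (hb : ∀ z ∈ S, f z = f b → z = b) : altLength (f a) (f b) (S.map f) = altLength a b S := by
  induction S generalizing a b with
  | nil => rfl
  | cons x S ih =>
    simp only [List.mem_cons, forall_eq_or_imp] at ha hb
    rw [List.map_cons, altLength_cons, altLength_cons, ih ha.2 hb.2, ih hb.2 ha.2]
    have : f x = f a ↔ x = a := ⟨ha.1, fun h => h ▸ rfl⟩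
    simp only [this]

theorem altLength_map_of_injective {f : ℕ → ℕ} (hf : Function.Injective f) (a b : ℕ)
    (S : List ℕ) : altLength (f a) (f b) (S.map f) = altLength a b S :=
  altLength_map (fun _ _ h => hf h) fun _ _ h => hf h

theorem altLength_append_of_notMem {a b : ℕ} {S T : List ℕ} (hb : b ∉ S) (ha : a ∉ T) :
    altLength a b (S ++ T) ≤ 2 ∧ altLength b a (S ++ T) ≤ 2 := by
  have h1 := altLength_of_notMem_right (a := a) hb
  have h2 := altLength_of_notMem_left (b := a) hb
  have h3 := altLength_of_notMem_right (a := b) ha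
  have h4 := altLength_of_notMem_left (b := b) ha
  rw [altLength_append, altLength_append]
  constructor <;> split_ifs at * <;> omega

theorem altLength_flatMap_congr {ι : Type*} {a b : ℕ} {f g : ι → List ℕ} {l : List ι}
    (h : ∀ i ∈ l, altLength a b (f i) = altLength a b (g i) ∧
      altLength b a (f i) = altLength b a (g i)) :
    altLength a b (l.flatMap f) = altLength a b (l.flatMap g) ∧
      altLength b a (l.flatMap f) = altLength b a (l.flatMap g) := by
  induction l with
  | nil => simp
  | cons i l ih =>
    simp only [List.mem_cons, forall_eq_or_imp] at h
    obtain ⟨h1, h2⟩ := ih h.2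
    simp only [List.flatMap_cons, altLength_append, h.1.1, h.1.2, h1, h2, and_self]

/-! ### First appearances -/

theorem firstAppearances_append_singleton (S : List ℕ) (z : ℕ) :
    firstAppearances (S ++ [z]) =
      if z ∈ S then firstAppearances S else firstAppearances S ++ [z] := by
  unfold firstAppearances
  rw [List.reverse_append, List.reverse_singleton, List.singleton_append]
  split_ifs with h
  · rw [List.dedup_cons_of_mem (List.mem_reverse.2 h)]
  · rw [List.dedup_cons_of_notMem (by simpa using h), List.reverse_cons]

theorem mem_firstAppearances {S : List ℕ} {x : ℕ} : x ∈ firstAppearances S ↔ x ∈ S := by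
  simp [firstAppearances]

theorem nodup_firstAppearances (S : List ℕ) : (firstAppearances S).Nodup := by
  simp [firstAppearances, List.nodup_dedup]

theorem length_firstAppearances (S : List ℕ) : (firstAppearances S).length = numSymbols S := by
  rw [← List.toFinset_card_of_nodup (nodup_firstAppearances S), numSymbols]
  congr 1
  ext; simp [mem_firstAppearances]

/-- The greedy run starting with `x` gains a lead of one at the first `x`, before any `y` has
occurred. From then on it awaits the same symbol as the run starting with `y`, so the lead never
changes. -/
theorem altLength_of_sublist_firstAppearances {x y : ℕ} (hxy : x ≠ y) (S : List ℕ)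
    (h : [x, y].Sublist (firstAppearances S)) : altLength x y S = altLength y x S + 1 := by
  induction S using List.reverseRecOn with
  | nil => simp [firstAppearances] at h
  | append_singleton S z ih =>
    have key : altLength x y S = altLength y x S + 1 := by
      rw [firstAppearances_append_singleton] at h
      split_ifs at h with hz
      · exact ih h
      · by_cases hzy : z = y
        · subst hzy
          have hx : x ∈ S := by
            have := h.subset (List.mem_cons_self)
            simpa [mem_firstAppearances, hxy] using this
          rw [altLength_of_notMem_left hz, altLength_of_notMem_right hz, if_pos hx]
        · apply ih
          obtain ⟨l₁, l₂, e, h1, h2⟩ := List.sublist_append_iff.1 h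
          rcases l₂ with _ | ⟨w, l₂⟩
          · simpa [e] using h1
          · exfalso
            have hy : y ∈ w :: l₂ := by
              have := congrArg List.getLast? e
              rw [List.getLast?_append_of_ne_nil _ (by simp)] at this
              exact List.mem_of_getLast? (by rw [← this]; rfl)
            exact hzy (by simpa [eq_comm] using h2.subset hy)
    -- The two lengths have opposite parities and opposite starting symbols, so `z` extends both
    -- runs or neither.
    simp only [altLength_append, key, Nat.even_add_one]
    split_ifs <;> omega

/-! ### Short alternations -/

theorem altLength_le_two_of_nodup (a b : ℕ) {S : List ℕ} (h : S.Nodup) :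
    altLength a b S ≤ 2 := by
  have := (altLength_le_count a b S).1
  have := List.nodup_iff_count_le_one.1 h a
  omega

theorem not_sublist_swap_of_nodup {a b : ℕ} {S : List ℕ} (h : S.Nodup)
    (h1 : [a, b].Sublist S) : ¬ [b, a].Sublist S := by
  induction S with
  | nil => simp at h1
  | cons x S ih =>
    rw [List.nodup_cons] at h
    intro h2
    rw [List.sublist_cons_iff] at h1 h2
    rcases h1 with h1 | ⟨r, e, h1⟩ <;> rcases h2 with h2 | ⟨r', e', h2⟩
    · exact ih h.2 h1 h2
    · simp only [List.cons.injEq] at e'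
      obtain ⟨rfl, rfl⟩ := e'
      exact h.1 (h1.subset (by simp))
    · simp only [List.cons.injEq] at e
      obtain ⟨rfl, rfl⟩ := e
      exact h.1 (h2.subset (by simp))
    · simp only [List.cons.injEq] at e e'
      obtain ⟨rfl, rfl⟩ := e
      exact h.1 (h1.subset (by simp [e'.1]))

/-- Restricted to two symbols the sequence is at worst abba. -/
theorem altLength_append_reverse_of_nodup (a b : ℕ) {S : List ℕ} (h : S.Nodup) :
    altLength a b (S ++ S.reverse) ≤ 3 := by
  have h1 := altLength_le_two_of_nodup a b h
  have h2 := altLength_le_two_of_nodup a b (List.nodup_reverse.2 h)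
  have h3 := altLength_le_two_of_nodup b a (List.nodup_reverse.2 h)
  have h4 : 2 ≤ altLength a b S → altLength a b S.reverse ≤ 1 := by
    intro h4
    by_contra h5
    refine not_sublist_swap_of_nodup h (pair_sublist_iff.2 h4) ?_
    simpa using (pair_sublist_iff.2 (show 2 ≤ altLength a b S.reverse by omega)).reverse
  rw [altLength_append]
  split_ifs with he
  · omega
  · have : altLength a b S ≠ 2 := by intro e; rw [e] at he; exact he even_two
    omega

/-! ### Distributing a sequence of blocks over copies of another one -/

/-- The `j`-th copy of `S'` with the symbols of `D` appended to its blocks. -/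
def distributeBlock (j : ℕ) (S' : List (List ℕ)) (D : List ℕ) : List (List ℕ) :=
  List.zipWith (fun P a => P.map (Nat.pair (j + 1)) ++ [Nat.pair 0 a]) S' D

/-- `distribute` with the copies numbered from `n`. -/
def distributeFrom (S' : List (List ℕ)) : ℕ → List (List ℕ) → List (List ℕ)
  | _, [] => []
  | n, D :: Shat => distributeBlock n S' D ++ distributeFrom S' (n + 1) Shat

theorem distributeFrom_eq (S' : List (List ℕ)) (n : ℕ) (Shat : List (List ℕ)) :
    (Shat.mapIdx fun j D => distributeBlock (j + n) S' D).flatten = distributeFrom S' n Shat := by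
  induction Shat generalizing n with
  | nil => simp [distributeFrom]
  | cons D Shat ih =>
    rw [List.mapIdx_cons, List.flatten_cons, distributeFrom, ← ih]
    simp only [Nat.zero_add, Nat.add_assoc, Nat.add_comm 1 n]

theorem distribute_eq (S' Shat : List (List ℕ)) :
    distribute S' Shat = distributeFrom S' 0 Shat := by
  rw [← distributeFrom_eq]; rfl

theorem distributeFrom_append (S' : List (List ℕ)) (n : ℕ) (X Y : List (List ℕ)) :
    distributeFrom S' n (X ++ Y) = distributeFrom S' n X ++ distributeFrom S' (n + X.length) Y := by
  induction X generalizing n with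
  | nil => simp [distributeFrom]
  | cons D X ih =>
    simp only [List.cons_append, distributeFrom, ih, List.append_assoc, List.length_cons]
    rw [Nat.add_right_comm, Nat.add_assoc n]

theorem mem_distributeBlock {j : ℕ} {S' : List (List ℕ)} {D B : List ℕ}
    (h : B ∈ distributeBlock j S' D) :
    ∃ P ∈ S', ∃ a ∈ D, B = P.map (Nat.pair (j + 1)) ++ [Nat.pair 0 a] := by
  rw [distributeBlock, ← List.map_uncurry_zip_eq_zipWith, List.mem_map] at h
  obtain ⟨⟨P, a⟩, h1, rfl⟩ := h
  exact ⟨P, (List.of_mem_zip h1).1, a, (List.of_mem_zip h1).2, rfl⟩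

theorem mem_distributeFrom {S' : List (List ℕ)} {n : ℕ} {Shat : List (List ℕ)} {B : List ℕ}
    (h : B ∈ distributeFrom S' n Shat) :
    ∃ j, n ≤ j ∧ j < n + Shat.length ∧ ∃ D ∈ Shat, ∃ P ∈ S', ∃ a ∈ D,
      B = P.map (Nat.pair (j + 1)) ++ [Nat.pair 0 a] := by
  induction Shat generalizing n with
  | nil => simp [distributeFrom] at h
  | cons D Shat ih =>
    rw [distributeFrom, List.mem_append] at h
    rcases h with h | h
    · obtain ⟨P, hP, a, ha, rfl⟩ := mem_distributeBlock h
      exact ⟨n, le_rfl, by simp, D, by simp, P, hP, a, ha, rfl⟩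
    · obtain ⟨j, h1, h2, D', hD', h3⟩ := ih h
      exact ⟨j, by omega, by simp only [List.length_cons]; omega, D', by simp [hD'], h3⟩

theorem lt_of_pair_succ_mem_distributeFrom {S' : List (List ℕ)} {n j b : ℕ}
    {Shat : List (List ℕ)} (h : Nat.pair (j + 1) b ∈ (distributeFrom S' n Shat).flatten) :
    n ≤ j ∧ j < n + Shat.length := by
  obtain ⟨B, hB, hb⟩ := List.mem_flatten.1 h
  obtain ⟨i, h1, h2, D, -, P, -, a, -, rfl⟩ := mem_distributeFrom hB
  simp only [List.mem_append, List.mem_map, Nat.pair_eq_pair, List.mem_singleton] at hb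
  rcases hb with ⟨_, -, h3, -⟩ | h3
  · exact ⟨by omega, by omega⟩
  · omega

theorem mem_of_pair_zero_mem_distributeBlock {S' : List (List ℕ)} {j a : ℕ} {D : List ℕ}
    (h : Nat.pair 0 a ∈ (distributeBlock j S' D).flatten) : a ∈ D := by
  obtain ⟨B, hB, hb⟩ := List.mem_flatten.1 h
  obtain ⟨P, -, c, hc, rfl⟩ := mem_distributeBlock hB
  simp only [List.mem_append, List.mem_map, Nat.pair_eq_pair, List.mem_singleton] at hb
  rcases hb with ⟨_, -, h3, -⟩ | h3
  · omega
  · exact h3.2 ▸ hc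

/-- The symbols with first component `c`. -/
def inClass (c z : ℕ) : Bool := z.unpair.1 == c

theorem inClass_pair (c d a : ℕ) : inClass c (Nat.pair d a) = (d == c) := by simp [inClass]

theorem filter_map_pair_self (c : ℕ) (l : List ℕ) :
    (l.map (Nat.pair c)).filter (inClass c) = l.map (Nat.pair c) := by
  rw [List.filter_eq_self]
  simp [inClass_pair]

theorem filter_map_pair_of_ne {c d : ℕ} (h : d ≠ c) (l : List ℕ) :
    (l.map (Nat.pair d)).filter (inClass c) = [] := by
  rw [List.filter_eq_nil_iff]
  simp [inClass_pair, h]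

theorem filter_zero_distributeBlock (j : ℕ) {S' : List (List ℕ)} {D : List ℕ}
    (h : D.length = S'.length) :
    (distributeBlock j S' D).flatten.filter (inClass 0) = D.map (Nat.pair 0) := by
  induction S' generalizing D with
  | nil => simp_all [distributeBlock]
  | cons P S' ih =>
    rcases D with _ | ⟨a, D⟩
    · simp at h
    · have := ih (D := D) (by simpa using h)
      simp only [distributeBlock, List.zipWith_cons_cons, List.flatten_cons, List.filter_append,
        filter_map_pair_of_ne (Nat.succ_ne_zero j)] at this ⊢
      simp [this, inClass_pair]

theorem filter_succ_distributeBlock (j : ℕ) {S' : List (List ℕ)} {D : List ℕ}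
    (h : D.length = S'.length) :
    (distributeBlock j S' D).flatten.filter (inClass (j + 1)) =
      S'.flatten.map (Nat.pair (j + 1)) := by
  induction S' generalizing D with
  | nil => simp [distributeBlock]
  | cons P S' ih =>
    rcases D with _ | ⟨a, D⟩
    · simp at h
    · have := ih (D := D) (by simpa using h)
      simp only [distributeBlock, List.zipWith_cons_cons, List.flatten_cons, List.filter_append,
        filter_map_pair_self] at this ⊢
      simp [this, inClass_pair]

theorem filter_zero_distributeFrom {S' : List (List ℕ)} (n : ℕ) {Shat : List (List ℕ)}
    (h : ∀ D ∈ Shat, D.length = S'.length) :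
    (distributeFrom S' n Shat).flatten.filter (inClass 0) = Shat.flatten.map (Nat.pair 0) := by
  induction Shat generalizing n with
  | nil => simp [distributeFrom]
  | cons D Shat ih =>
    simp only [List.mem_cons, forall_eq_or_imp] at h
    simp only [distributeFrom, List.flatten_append, List.filter_append,
      filter_zero_distributeBlock n h.1, ih (n + 1) h.2, List.flatten_cons, List.map_append]

theorem filter_succ_distributeFrom_eq_nil {S' : List (List ℕ)} {n j : ℕ} {Shat : List (List ℕ)}
    (h : ¬ (n ≤ j ∧ j < n + Shat.length)) :
    (distributeFrom S' n Shat).flatten.filter (inClass (j + 1)) = [] := by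
  rw [List.filter_eq_nil_iff]
  intro z hz hc
  rw [← Nat.pair_unpair z] at hz hc
  rw [inClass_pair, beq_iff_eq] at hc
  rw [hc] at hz
  exact h (lt_of_pair_succ_mem_distributeFrom hz)

theorem filter_succ_distributeFrom {S' : List (List ℕ)} (n : ℕ) {X Y : List (List ℕ)}
    {D : List ℕ} (h : D.length = S'.length) :
    (distributeFrom S' n (X ++ D :: Y)).flatten.filter (inClass (n + X.length + 1)) =
      S'.flatten.map (Nat.pair (n + X.length + 1)) := by
  rw [distributeFrom_append, distributeFrom, List.flatten_append, List.flatten_append,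
    List.filter_append, List.filter_append, filter_succ_distributeBlock _ h,
    filter_succ_distributeFrom_eq_nil (by omega), filter_succ_distributeFrom_eq_nil (by omega)]
  simp

theorem distributeBlock_eq_append_cons {j : ℕ} {S' : List (List ℕ)} {D : List ℕ}
    {U : List (List ℕ)} {B : List ℕ} {V : List (List ℕ)} (hD : D.length = S'.length)
    (h : distributeBlock j S' D = U ++ B :: V) :
    ∃ S₁ P S₂ D₁ a D₂, S' = S₁ ++ P :: S₂ ∧ D = D₁ ++ a :: D₂ ∧ D₁.length = S₁.length ∧
      B = P.map (Nat.pair (j + 1)) ++ [Nat.pair 0 a] ∧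
      U = distributeBlock j S₁ D₁ ∧ V = distributeBlock j S₂ D₂ := by
  induction S' generalizing D U with
  | nil => simp [distributeBlock] at h
  | cons P S' ih =>
    rcases D with _ | ⟨a, D⟩
    · simp at hD
    rw [distributeBlock, List.zipWith_cons_cons, ← distributeBlock] at h
    rcases U with _ | ⟨B', U⟩
    · simp only [List.nil_append, List.cons.injEq] at h
      exact ⟨[], P, S', [], a, D, rfl, rfl, rfl, h.1.symm, rfl, h.2.symm⟩
    · simp only [List.cons_append, List.cons.injEq] at h
      obtain ⟨S₁, P', S₂, D₁, a', D₂, rfl, rfl, h1, h2, h3, h4⟩ := ih (by simpa using hD) h.2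
      refine ⟨P :: S₁, P', S₂, a :: D₁, a', D₂, rfl, rfl, by simp [h1], h2, ?_, h4⟩
      rw [distributeBlock, List.zipWith_cons_cons, ← distributeBlock, ← h3, h.1]

/-- Cutting the result at a block amounts to cutting `Shat` at some `D` and, inside the
corresponding copy, `S'` at some `P`. The invariant `outside` is checked in this form. -/
theorem distributeFrom_eq_append_cons {S' : List (List ℕ)} {n : ℕ} {Shat : List (List ℕ)}
    {U : List (List ℕ)} {B : List ℕ} {V : List (List ℕ)}
    (hD : ∀ D ∈ Shat, D.length = S'.length)
    (h : distributeFrom S' n Shat = U ++ B :: V) :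
    ∃ j X D Y S₁ P S₂ D₁ a D₂, j = n + X.length ∧ Shat = X ++ D :: Y ∧
      S' = S₁ ++ P :: S₂ ∧ D = D₁ ++ a :: D₂ ∧ D₁.length = S₁.length ∧
      B = P.map (Nat.pair (j + 1)) ++ [Nat.pair 0 a] ∧
      U = distributeFrom S' n X ++ distributeBlock j S₁ D₁ ∧
      V = distributeBlock j S₂ D₂ ++ distributeFrom S' (j + 1) Y := by
  induction Shat generalizing n U with
  | nil => simp [distributeFrom] at h
  | cons D Shat ih =>
    simp only [List.mem_cons, forall_eq_or_imp] at hD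
    rw [distributeFrom, List.append_eq_append_iff] at h
    have key : ∀ M, distributeBlock n S' D = U ++ B :: M →
        V = M ++ distributeFrom S' (n + 1) Shat → ∃ j X D' Y S₁ P S₂ D₁ a D₂, j = n + X.length ∧
        D :: Shat = X ++ D' :: Y ∧
        S' = S₁ ++ P :: S₂ ∧ D' = D₁ ++ a :: D₂ ∧ D₁.length = S₁.length ∧
        B = P.map (Nat.pair (j + 1)) ++ [Nat.pair 0 a] ∧
        U = distributeFrom S' n X ++ distributeBlock j S₁ D₁ ∧
        V = distributeBlock j S₂ D₂ ++ distributeFrom S' (j + 1) Y := by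
      intro M h1 h2
      obtain ⟨S₁, P, S₂, D₁, a, D₂, e1, e2, e3, e4, e5, e6⟩ :=
        distributeBlock_eq_append_cons hD.1 h1
      exact ⟨n, [], D, Shat, S₁, P, S₂, D₁, a, D₂, rfl, rfl, e1, e2, e3, e4,
        by simp [distributeFrom, e5], by rw [h2, e6]⟩
    have key2 : ∀ M, U = distributeBlock n S' D ++ M →
        distributeFrom S' (n + 1) Shat = M ++ B :: V →
        ∃ j X D' Y S₁ P S₂ D₁ a D₂, j = n + X.length ∧ D :: Shat = X ++ D' :: Y ∧
        S' = S₁ ++ P :: S₂ ∧ D' = D₁ ++ a :: D₂ ∧ D₁.length = S₁.length ∧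
        B = P.map (Nat.pair (j + 1)) ++ [Nat.pair 0 a] ∧
        U = distributeFrom S' n X ++ distributeBlock j S₁ D₁ ∧
        V = distributeBlock j S₂ D₂ ++ distributeFrom S' (j + 1) Y := by
      intro M h1 h2
      obtain ⟨j, X, D', Y, S₁, P, S₂, D₁, a, D₂, e0, e1, e2, e3, e4, e5, e6, e7⟩ := ih hD.2 h2
      refine ⟨j, D :: X, D', Y, S₁, P, S₂, D₁, a, D₂, by simp only [List.length_cons]; omega,
        by rw [e1]; rfl, e2, e3, e4, e5, ?_, e7⟩
      rw [h1, e6, distributeFrom, List.append_assoc]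
    rcases h with ⟨M, h1, h2⟩ | ⟨M, h1, h2⟩
    · exact key2 M h1 h2
    · rcases M with _ | ⟨B', M⟩
      · refine key2 [] (by simpa using h1.symm) (by simpa using h2.symm)
      · simp only [List.cons_append, List.cons.injEq] at h2
        obtain ⟨rfl, h2⟩ := h2
        exact key M h1 h2

theorem length_distributeFrom {S' : List (List ℕ)} (n : ℕ) {Shat : List (List ℕ)}
    (h : ∀ D ∈ Shat, D.length = S'.length) :
    (distributeFrom S' n Shat).length = Shat.length * S'.length := by
  induction Shat generalizing n with
  | nil => simp [distributeFrom]
  | cons D Shat ih =>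
    simp only [List.mem_cons, forall_eq_or_imp] at h
    rw [distributeFrom, List.length_append, ih _ h.2, distributeBlock, List.length_zipWith, h.1,
      List.length_cons]
    simp; ring

/-- The symbol q of copy `d` is confined to that copy, where p occurs at most once. The worst case
is therefore p, then q p q inside the copy, then p. -/
theorem altLength_distributeFrom_of_ne {S' : List (List ℕ)} {Shat : List (List ℕ)}
    (hD : ∀ D ∈ Shat, D.length = S'.length ∧ D.Nodup) {c d x b : ℕ} (hne : c ≠ d + 1) :
    altLength (Nat.pair c x) (Nat.pair (d + 1) b) (distributeFrom S' 0 Shat).flatten ≤ 5 ∧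
    altLength (Nat.pair (d + 1) b) (Nat.pair c x) (distributeFrom S' 0 Shat).flatten ≤ 5 := by
  set p := Nat.pair c x with hp
  set q := Nat.pair (d + 1) b with hq
  have bound : ∀ W : List ℕ, q ∉ W → altLength p q W ≤ 1 ∧ altLength q p W = 0 := by
    intro W h
    rw [altLength_of_notMem_right h, altLength_of_notMem_left h]
    split_ifs <;> simp
  by_cases hd : d < Shat.length
  · obtain ⟨X, D, Y, rfl, rfl⟩ : ∃ X D Y, Shat = X ++ D :: Y ∧ X.length = d :=
      ⟨Shat.take d, Shat[d], Shat.drop (d + 1),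
        by rw [← List.drop_eq_getElem_cons hd, List.take_append_drop],
        by rw [List.length_take]; omega⟩
    have hD' := hD D (by simp)
    rw [distributeFrom_append, distributeFrom, List.flatten_append, List.flatten_append]
    have h1 := bound (distributeFrom S' 0 X).flatten
      fun h => by have := lt_of_pair_succ_mem_distributeFrom h; omega
    have h2 := bound (distributeFrom S' (0 + X.length + 1) Y).flatten
      fun h => by have := lt_of_pair_succ_mem_distributeFrom h; omega
    -- A symbol of `Shat` occurs at most once because `D` has no repetitions; a symbol of another
    -- copy does not occur at all.
    have h3 : (distributeBlock (0 + X.length) S' D).flatten.count p ≤ 1 := by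
      rcases c with _ | c
      · rw [← List.count_filter (p := inClass 0) (by simp [hp, inClass_pair]),
          filter_zero_distributeBlock _ hD'.1]
        exact List.nodup_iff_count_le_one.1
          (hD'.2.map fun _ _ h => (Nat.pair_eq_pair.1 h).2) _
      · rw [List.count_eq_zero_of_not_mem]
        · omega
        · intro h
          have : distributeBlock (0 + X.length) S' D = distributeFrom S' (0 + X.length) [D] := by
            simp [distributeFrom]
          rw [this] at h
          have := lt_of_pair_succ_mem_distributeFrom h
          simp only [List.length_singleton] at this
          omega
    have h4 := altLength_le_count p q (distributeBlock (0 + X.length) S' D).flatten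
    simp only [altLength_append]
    constructor <;> split_ifs <;> omega
  · have := bound (distributeFrom S' 0 Shat).flatten
      fun h => by have := lt_of_pair_succ_mem_distributeFrom h; omega
    omega

/-! ### Replacing blocks -/

/-- The renameSymbol used in `copyOn`. -/
def renameSymbol (Sbar : List (List ℕ)) (B : List ℕ) (x : ℕ) : ℕ :=
  B.getD ((firstAppearances Sbar.flatten).idxOf x) 0

theorem flatten_copyOn (Sbar : List (List ℕ)) (B : List ℕ) :
    (copyOn Sbar B).flatten = Sbar.flatten.map (renameSymbol Sbar B) := by
  rw [List.map_flatten]; rfl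

/-- The lengths agree, so the default value 0 of `getD` is never reached. Injectivity of the
renaming, its image and the order of first appearances in a copy all follow from this identity. -/
theorem map_renameSymbol {Sbar : List (List ℕ)} {B : List ℕ}
    (h : B.length = numSymbols Sbar.flatten) :
    (firstAppearances Sbar.flatten).map (renameSymbol Sbar B) = B := by
  have hl := length_firstAppearances Sbar.flatten
  apply List.ext_getElem (by simp [h, hl])
  intro i h1 h2
  rw [List.getElem_map, renameSymbol, List.Nodup.idxOf_getElem (nodup_firstAppearances _),
    List.getD_eq_getElem _ _ h2]

theorem renameSymbol_injOn {Sbar : List (List ℕ)} {B : List ℕ}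
    (h : B.length = numSymbols Sbar.flatten) (hB : B.Nodup) {x y : ℕ} (hx : x ∈ Sbar.flatten)
    (hy : y ∈ Sbar.flatten) (hxy : renameSymbol Sbar B x = renameSymbol Sbar B y) : x = y := by
  rw [← map_renameSymbol h] at hB
  exact List.inj_on_of_nodup_map hB (mem_firstAppearances.2 hx) (mem_firstAppearances.2 hy) hxy

theorem mem_flatten_copyOn {Sbar : List (List ℕ)} {B : List ℕ}
    (h : B.length = numSymbols Sbar.flatten) {a : ℕ} :
    a ∈ (copyOn Sbar B).flatten ↔ a ∈ B := by
  conv_rhs => rw [← map_renameSymbol h]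
  simp only [flatten_copyOn, List.mem_map, mem_firstAppearances]

theorem count_flatten_copyOn {Sbar : List (List ℕ)} {B : List ℕ} {μ : ℕ}
    (h : B.length = numSymbols Sbar.flatten) (hB : B.Nodup)
    (hμ : ∀ a ∈ Sbar.flatten, Sbar.flatten.count a = μ) (a : ℕ) :
    (copyOn Sbar B).flatten.count a = μ * B.count a := by
  by_cases ha : a ∈ B
  · rw [List.count_eq_one_of_mem hB ha, mul_one]
    have ha' := (mem_flatten_copyOn h).2 ha
    rw [flatten_copyOn, List.mem_map] at ha'
    obtain ⟨x, hx, rfl⟩ := ha'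
    rw [flatten_copyOn, ← hμ x hx, List.count, List.countP_map, List.count]
    apply List.countP_congr
    intro z hz
    simp only [Function.comp, beq_iff_eq]
    exact ⟨fun e => renameSymbol_injOn h hB hz hx e, fun e => by rw [e]⟩
  · rw [List.count_eq_zero_of_not_mem ha, mul_zero, List.count_eq_zero]
    exact fun h' => ha ((mem_flatten_copyOn h).1 h')

theorem altLength_copyOn_of_sublist {Sbar : List (List ℕ)} {B : List ℕ} {s : ℕ}
    (h : B.length = numSymbols Sbar.flatten) (hB : B.Nodup)
    (hs : ∀ a b, a ≠ b → altLength a b Sbar.flatten ≤ s) {x y : ℕ} (hxy : x ≠ y)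
    (hx : [x, y].Sublist B) :
    altLength x y (copyOn Sbar B).flatten = altLength y x (copyOn Sbar B).flatten + 1 ∧
      altLength x y (copyOn Sbar B).flatten ≤ s := by
  rw [← map_renameSymbol h, List.sublist_map_iff] at hx
  obtain ⟨l, hl, e₁⟩ := hx
  obtain ⟨x', l, rfl, rfl, e₂⟩ := List.map_eq_cons_iff.1 e₁.symm
  obtain ⟨y', l, rfl, rfl, e₃⟩ := List.map_eq_cons_iff.1 e₂
  obtain rfl := List.map_eq_nil_iff.1 e₃
  have hne : x' ≠ y' := by rintro rfl; exact hxy rfl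
  have hx' : x' ∈ Sbar.flatten := mem_firstAppearances.1 (hl.subset (by simp))
  have hy' : y' ∈ Sbar.flatten := mem_firstAppearances.1 (hl.subset (by simp))
  have hx'' := fun z hz => renameSymbol_injOn h hB (x := z) hz hx'
  have hy'' := fun z hz => renameSymbol_injOn h hB (x := z) hz hy'
  rw [flatten_copyOn, altLength_map hx'' hy'', altLength_map hy'' hx'']
  exact ⟨altLength_of_sublist_firstAppearances hne _ hl, hs _ _ hne⟩

theorem length_replaceBlocks (Sbar Sstar : List (List ℕ)) :
    (replaceBlocks Sbar Sstar).length = Sstar.length * Sbar.length := by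
  simp [replaceBlocks, List.length_flatMap, copyOn]

/-- When at most one of the two symbols is present, only its presence matters, and a copy has the
same symbols as its block. -/
theorem altLength_copyOn_of_not_both {Sbar : List (List ℕ)} {B : List ℕ}
    (h : B.length = numSymbols Sbar.flatten) {x y : ℕ} (hxy : ¬ (x ∈ B ∧ y ∈ B)) :
    altLength x y (copyOn Sbar B).flatten = altLength x y B := by
  by_cases hy : y ∈ B
  · have hx : x ∉ B := fun hx => hxy ⟨hx, hy⟩
    rw [altLength_of_notMem_left hx,
      altLength_of_notMem_left fun h' => hx ((mem_flatten_copyOn h).1 h')]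
  · rw [altLength_of_notMem_right hy,
      altLength_of_notMem_right fun h' => hy ((mem_flatten_copyOn h).1 h')]
    simp only [mem_flatten_copyOn h]

theorem altLength_replaceBlocks {Sbar Sstar : List (List ℕ)}
    (h : ∀ B ∈ Sstar, B.length = numSymbols Sbar.flatten) {x y : ℕ}
    (hxy : ∀ B ∈ Sstar, ¬ (x ∈ B ∧ y ∈ B)) :
    altLength x y (replaceBlocks Sbar Sstar).flatten = altLength x y Sstar.flatten ∧
      altLength y x (replaceBlocks Sbar Sstar).flatten = altLength y x Sstar.flatten := by
  have := altLength_flatMap_congr (a := x) (b := y) (l := Sstar)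
    (f := fun B => (copyOn Sbar B).flatten) (g := id) fun B hB =>
      ⟨altLength_copyOn_of_not_both (h B hB) (hxy B hB),
        altLength_copyOn_of_not_both (h B hB) fun h' => hxy B hB h'.symm⟩
  rw [List.flatMap_id] at this
  have e : (replaceBlocks Sbar Sstar).flatten = Sstar.flatMap fun B => (copyOn Sbar B).flatten := by
    simp only [replaceBlocks, List.flatMap_def, List.flatten_flatten, List.map_map]; rfl
  rwa [e]

/-! ### The invariants of the construction -/

/-- A nonempty sequence of blocks of `m` distinct symbols without alternations of length `s + 2`,
in which every symbol has multiplicity `μ`. -/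
structure IsUniform (s μ m : ℕ) (L : List (List ℕ)) : Prop where
  ne_nil : L ≠ []
  length_nodup : ∀ B ∈ L, B.length = m ∧ B.Nodup
  altLength_le : ∀ a b, a ≠ b → altLength a b L.flatten ≤ s + 1
  count_eq : ∀ a ∈ L.flatten, L.flatten.count a = μ

/-- Moreover, the position of a symbol in the blocks is always the same, and two symbols `x, y`
that share a block, in this order, appear as `y … y x … x` before this block and as
`x … x y … y` after it. -/
structure IsPositional (s μ m : ℕ) (L : List (List ℕ)) : Prop extends IsUniform s μ m L where
  position : ∃ pos : ℕ → ℕ, ∀ B ∈ L, ∀ a ∈ B, B.idxOf a = pos a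
  outside : ∀ U B V, L = U ++ B :: V → ∀ x y, x ≠ y → [x, y].Sublist B →
    ¬ [x, y].Sublist U.flatten ∧ ¬ [y, x].Sublist V.flatten

theorem pair_sublist_of_mem {x y : ℕ} {B : List ℕ} (hx : x ∈ B) (hy : y ∈ B) (hxy : x ≠ y) :
    [x, y].Sublist B ∨ [y, x].Sublist B := by
  induction B with
  | nil => simp at hx
  | cons z B ih =>
    rw [List.mem_cons] at hx hy
    rcases hx with rfl | hx
    · have hy := hy.resolve_left hxy.symm
      exact Or.inl ((List.singleton_sublist.2 hy).cons_cons x)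
    · rcases hy with rfl | hy
      · exact Or.inr ((List.singleton_sublist.2 hx).cons_cons y)
      · exact (ih hx hy).imp (fun h => h.cons z) fun h => h.cons z

theorem idxOf_lt_of_pair_sublist {x y : ℕ} {B : List ℕ} (hB : B.Nodup)
    (h : [x, y].Sublist B) : B.idxOf x < B.idxOf y := by
  induction B with
  | nil => simp at h
  | cons z B ih =>
    rw [List.nodup_cons] at hB
    rw [List.sublist_cons_iff] at h
    rcases h with h | ⟨r, e, h⟩
    · have hx : x ≠ z := fun e => hB.1 (e ▸ h.subset (by simp))
      have hy : y ≠ z := fun e => hB.1 (e ▸ h.subset (by simp))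
      rw [List.idxOf_cons_ne _ hx.symm, List.idxOf_cons_ne _ hy.symm]
      exact Nat.succ_lt_succ (ih hB.2 h)
    · simp only [List.cons.injEq] at e
      obtain ⟨rfl, rfl⟩ := e
      have hy : y ∈ B := h.subset (by simp)
      have hyx : y ≠ x := fun e => hB.1 (e ▸ hy)
      rw [List.idxOf_cons_self, List.idxOf_cons_ne _ hyx.symm]
      omega

/-- Two distinct symbols share at most one block. -/
theorem IsPositional.not_mem_both {s μ m : ℕ} {L : List (List ℕ)} (h : IsPositional s μ m L)
    {U V : List (List ℕ)} {B B' : List ℕ} (hL : L = U ++ B :: V) (hB' : B' ∈ V) {x y : ℕ}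
    (hxy : x ≠ y) (hB : x ∈ B ∧ y ∈ B) : ¬ (x ∈ B' ∧ y ∈ B') := by
  rintro ⟨hx, hy⟩
  wlog hs : [x, y].Sublist B generalizing x y
  · exact this hxy.symm hB.symm hy hx ((pair_sublist_of_mem hB.1 hB.2 hxy).resolve_left hs)
  obtain ⟨V₁, V₂, rfl⟩ := List.append_of_mem hB'
  obtain ⟨pos, hpos⟩ := h.position
  have hBL : B ∈ L := by simp [hL]
  have hBL' : B' ∈ L := by simp [hL]
  -- Fixed positions give x and y the same order in `B'` as in `B`; but then `B` is an occurrence of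
  -- x, y before `B'`, which `outside` forbids.
  have hlt := idxOf_lt_of_pair_sublist (h.length_nodup B hBL).2 hs
  rw [hpos B hBL x hB.1, hpos B hBL y hB.2, ← hpos B' hBL' x hx, ← hpos B' hBL' y hy] at hlt
  rcases pair_sublist_of_mem hx hy hxy with h' | h'
  · refine (h.outside (U ++ B :: V₁) B' V₂ (by simp [hL]) x y hxy h').1 (hs.trans ?_)
    exact List.sublist_flatten_of_mem (by simp)
  · exact absurd (idxOf_lt_of_pair_sublist (h.length_nodup B' hBL').2 h') hlt.le.not_gt

/-- A pair sharing no block alternates as in `Sstar`. A pair sharing a block shares only that one,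
so only its copy has to be combined with the patterns before and after it. -/
theorem IsUniform.of_replaceBlocks {s μ₁ μ₂ f : ℕ} (hs : Even s) {Sbar Sstar : List (List ℕ)}
    (h1 : IsUniform s μ₁ f Sbar)
    (h2 : IsPositional (s + 2) μ₂ (numSymbols Sbar.flatten) Sstar) :
    IsUniform (s + 2) (μ₁ * μ₂) f (replaceBlocks Sbar Sstar) := by
  have hlen : ∀ B ∈ Sstar, B.length = numSymbols Sbar.flatten :=
    fun B hB => (h2.length_nodup B hB).1
  have hcount : ∀ a, (replaceBlocks Sbar Sstar).flatten.count a = μ₁ * Sstar.flatten.count a := by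
    intro a
    have : ∀ T : List (List ℕ), (∀ B ∈ T, B.length = numSymbols Sbar.flatten ∧ B.Nodup) →
        (replaceBlocks Sbar T).flatten.count a = μ₁ * T.flatten.count a := by
      intro T hT
      induction T with
      | nil => simp [replaceBlocks]
      | cons B T ih =>
        simp only [List.mem_cons, forall_eq_or_imp] at hT
        have := ih hT.2
        rw [replaceBlocks] at this ⊢
        rw [List.flatMap_cons, List.flatten_append, List.count_append, this, List.flatten_cons,
          List.count_append, count_flatten_copyOn hT.1.1 hT.1.2 h1.count_eq, mul_add]
    exact this Sstar h2.length_nodup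
  refine ⟨?_, ?_, ?_, ?_⟩
  · rw [← List.length_pos_iff, length_replaceBlocks]
    exact Nat.mul_pos (List.length_pos_iff.2 h2.ne_nil) (List.length_pos_iff.2 h1.ne_nil)
  · intro Q hQ
    obtain ⟨B, hB, hQ⟩ := List.mem_flatMap.1 hQ
    obtain ⟨P, hP, rfl⟩ := List.mem_map.1 hQ
    refine ⟨by rw [List.length_map, (h1.length_nodup P hP).1], ?_⟩
    refine List.Nodup.map_on ?_ (h1.length_nodup P hP).2
    intro x hx y hy e
    exact renameSymbol_injOn (hlen B hB) (h2.length_nodup B hB).2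
      (List.mem_flatten_of_mem hP hx) (List.mem_flatten_of_mem hP hy) e
  · intro a b hab
    by_cases hex : ∃ B ∈ Sstar, a ∈ B ∧ b ∈ B
    · obtain ⟨B, hB, ha, hb⟩ := hex
      obtain ⟨U, V, rfl⟩ := List.append_of_mem hB
      have hU : ∀ B' ∈ U, ¬ (a ∈ B' ∧ b ∈ B') := by
        intro B' hB' hab'
        obtain ⟨U₁, U₂, rfl⟩ := List.append_of_mem hB'
        exact h2.not_mem_both (U := U₁) (B := B') (V := U₂ ++ B :: V) (by simp) (by simp)
          hab hab' ⟨ha, hb⟩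
      have hV : ∀ B' ∈ V, ¬ (a ∈ B' ∧ b ∈ B') :=
        fun B' hB' => h2.not_mem_both rfl hB' hab ⟨ha, hb⟩
      have eU := altLength_replaceBlocks (Sbar := Sbar) (fun B' hB' => hlen B' (by simp [hB'])) hU
      have eV := altLength_replaceBlocks (Sbar := Sbar) (fun B' hB' => hlen B' (by simp [hB'])) hV
      have e : (replaceBlocks Sbar (U ++ B :: V)).flatten = (replaceBlocks Sbar U).flatten ++
          ((copyOn Sbar B).flatten ++ (replaceBlocks Sbar V).flatten) := by
        simp [replaceBlocks]
      rw [e]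
      simp only [altLength_append, eU.1, eV.1, eV.2]
      have hU1 := altLength_le_succ a b U.flatten
      have hU2 := altLength_le_succ b a U.flatten
      have hV1 := altLength_le_succ a b V.flatten
      have hV2 := altLength_le_succ b a V.flatten
      -- Say x precedes y in `B`. The prefix contributes at most y x, then the copy at most s more
      -- starting with y; or y, then the copy at most s+1 starting with x. As s is even, either full
      -- run ends in x and awaits y, so the suffix x…x y…y adds one symbol only. A shorter run may
      -- gain two there, but the total stays within s+3.
      simp only [Nat.even_iff] at hs ⊢
      rcases pair_sublist_of_mem ha hb hab with hxy | hxy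
      · obtain ⟨h3, h4⟩ := h2.outside U B V rfl a b hab hxy
        have := altLength_copyOn_of_sublist (hlen B hB) (h2.length_nodup B hB).2 h1.altLength_le
          hab hxy
        rw [pair_sublist_iff] at h3 h4
        split_ifs <;> omega
      · obtain ⟨h3, h4⟩ := h2.outside U B V rfl b a hab.symm hxy
        have := altLength_copyOn_of_sublist (hlen B hB) (h2.length_nodup B hB).2 h1.altLength_le
          hab.symm hxy
        rw [pair_sublist_iff] at h3 h4
        split_ifs <;> omega
    · push Not at hex
      rw [(altLength_replaceBlocks hlen fun B hB h => hex B hB h.1 h.2).1]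
      exact h2.altLength_le a b hab
  · intro a ha
    rw [hcount]
    have := List.count_pos_iff.2 ha
    rw [hcount] at this
    rw [h2.count_eq a (List.count_pos_iff.1 (Nat.pos_of_mul_pos_left this))]

theorem count_map_pair (c b : ℕ) (l : List ℕ) :
    (l.map (Nat.pair c)).count (Nat.pair c b) = l.count b :=
  List.count_map_of_injective _ _ (fun _ _ h => (Nat.pair_eq_pair.1 h).2) _

theorem pair_sublist_map_pair {c x y : ℕ} {l : List ℕ} :
    [Nat.pair c x, Nat.pair c y].Sublist (l.map (Nat.pair c)) ↔ [x, y].Sublist l := by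
  rw [pair_sublist_iff, pair_sublist_iff,
    altLength_map_of_injective fun _ _ h => (Nat.pair_eq_pair.1 h).2]

theorem pair_sublist_filter {f : ℕ → Bool} {x y : ℕ} (hx : f x) (hy : f y) {l : List ℕ} :
    [x, y].Sublist (l.filter f) ↔ [x, y].Sublist l := by
  rw [pair_sublist_iff, pair_sublist_iff, altLength_filter hx hy]

theorem pair_sublist_of_append_left {x y : ℕ} {S T : List ℕ} (hx : x ∉ S)
    (h : [x, y].Sublist (S ++ T)) : [x, y].Sublist T := by
  rw [pair_sublist_iff, altLength_append, altLength_of_notMem_left hx] at h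
  simpa [pair_sublist_iff] using h

theorem pair_sublist_of_append_right {x y : ℕ} {S T : List ℕ} (hy : y ∉ T)
    (h : [x, y].Sublist (S ++ T)) : [x, y].Sublist S := by
  have := h.reverse
  rw [List.reverse_append] at this
  simpa using (pair_sublist_of_append_left (by simpa using hy) this).reverse

theorem idxOf_map_of_injective {f : ℕ → ℕ} (hf : Function.Injective f) (a : ℕ) (l : List ℕ) :
    (l.map f).idxOf (f a) = l.idxOf a := by
  induction l with
  | nil => rfl
  | cons x l ih => simp only [List.map_cons, List.idxOf_cons, ih, beq_eq_decide, hf.eq_iff]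

/-- The first component of `Nat.pair` records the origin of a symbol. Filtering by it recovers
`Shat` or a copy of `S'`, so properties within one origin are inherited; mixed pairs alternate at
most five times, which is where `4 ≤ s` enters. -/
theorem IsPositional.of_distribute {s μ m : ℕ} (hs : 4 ≤ s) {S' Shat : List (List ℕ)}
    (h1 : IsPositional s μ m S') (h2 : IsUniform s μ S'.length Shat) :
    IsPositional s μ (m + 1) (distribute S' Shat) := by
  have hlen : ∀ D ∈ Shat, D.length = S'.length := fun D hD => (h2.length_nodup D hD).1
  have hinj : ∀ c, Function.Injective (Nat.pair c) := fun c _ _ h => (Nat.pair_eq_pair.1 h).2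
  rw [distribute_eq]
  obtain ⟨pos, hpos⟩ := h1.position
  have hclass : ∀ c, (distributeFrom S' 0 Shat).flatten.filter (inClass c) = [] ∨
      ∃ L, IsUniform s μ (if c = 0 then S'.length else m) L ∧
        (distributeFrom S' 0 Shat).flatten.filter (inClass c) = L.flatten.map (Nat.pair c) := by
    rintro (_ | d)
    · exact Or.inr ⟨Shat, h2, filter_zero_distributeFrom 0 hlen⟩
    · by_cases hd : d < Shat.length
      · obtain ⟨X, D, Y, rfl, rfl⟩ : ∃ X D Y, Shat = X ++ D :: Y ∧ X.length = d :=
          ⟨Shat.take d, Shat[d], Shat.drop (d + 1),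
            by rw [← List.drop_eq_getElem_cons hd, List.take_append_drop],
            by rw [List.length_take]; omega⟩
        right
        refine ⟨S', h1.toIsUniform, ?_⟩
        simpa using filter_succ_distributeFrom 0 (X := X) (Y := Y) (hlen D (by simp))
      · exact Or.inl (filter_succ_distributeFrom_eq_nil (by omega))
  refine ⟨⟨?_, ?_, ?_, ?_⟩, ?_, ?_⟩
  · rw [← List.length_pos_iff, length_distributeFrom 0 hlen]
    exact Nat.mul_pos (List.length_pos_iff.2 h2.ne_nil) (List.length_pos_iff.2 h1.ne_nil)
  · intro B hB
    obtain ⟨j, -, -, D, hD, P, hP, a, ha, rfl⟩ := mem_distributeFrom hB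
    refine ⟨by simp [(h1.length_nodup P hP).1], ?_⟩
    rw [List.nodup_append]
    refine ⟨(h1.length_nodup P hP).2.map (hinj _), by simp, ?_⟩
    intro p hp q hq e
    obtain ⟨b, -, rfl⟩ := List.mem_map.1 hp
    rw [List.mem_singleton] at hq
    have := (Nat.pair_eq_pair.1 (e.trans hq)).1
    omega
  · intro p q hpq
    obtain ⟨c, a, rfl⟩ : ∃ c a, p = Nat.pair c a := ⟨_, _, (Nat.pair_unpair p).symm⟩
    obtain ⟨d, b, rfl⟩ : ∃ d b, q = Nat.pair d b := ⟨_, _, (Nat.pair_unpair q).symm⟩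
    by_cases hcd : c = d
    · subst hcd
      rw [← altLength_filter (f := inClass c) (by simp [inClass_pair]) (by simp [inClass_pair])]
      rcases hclass c with h | ⟨L, hL, h⟩
      · simp [h, altLength]
      · rw [h, altLength_map_of_injective (hinj c)]
        exact hL.altLength_le a b fun e => hpq (by rw [e])
    · have hD : ∀ D ∈ Shat, D.length = S'.length ∧ D.Nodup := h2.length_nodup
      rcases d with _ | d
      · obtain ⟨c, rfl⟩ := Nat.exists_eq_succ_of_ne_zero hcd
        have := (altLength_distributeFrom_of_ne hD (c := 0) (d := c) (x := b) (b := a)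
          (by omega)).2
        rw [Nat.succ_eq_add_one]
        omega
      · have := (altLength_distributeFrom_of_ne hD (x := a) (b := b) hcd).1
        omega
  · intro p hp
    obtain ⟨c, a, rfl⟩ : ∃ c a, p = Nat.pair c a := ⟨_, _, (Nat.pair_unpair p).symm⟩
    have hc : inClass c (Nat.pair c a) := by simp [inClass_pair]
    have hp' := List.mem_filter.2 ⟨hp, hc⟩
    rw [← List.count_filter hc]
    rcases hclass c with h | ⟨L, hL, h⟩
    · simp [h] at hp'
    · rw [h] at hp' ⊢
      rw [count_map_pair]
      obtain ⟨a', ha', e⟩ := List.mem_map.1 hp'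
      rw [hinj c e] at ha'
      exact hL.count_eq a ha'
  · refine ⟨fun z => if z.unpair.1 = 0 then m else pos z.unpair.2, ?_⟩
    intro B hB p hp
    obtain ⟨j, -, -, D, hD, P, hP, a, ha, rfl⟩ := mem_distributeFrom hB
    rw [List.mem_append, List.mem_singleton] at hp
    by_cases hpP : p ∈ P.map (Nat.pair (j + 1))
    · obtain ⟨b, hb, rfl⟩ := List.mem_map.1 hpP
      rw [List.idxOf_append_of_mem hpP]
      simp only [Nat.unpair_pair, Nat.add_eq_zero_iff, one_ne_zero, and_false, if_false]
      rw [← hpos P hP b hb]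
      exact idxOf_map_of_injective (hinj _) _ _
    · obtain rfl := hp.resolve_left hpP
      rw [List.idxOf_append_of_notMem hpP]
      simp [(h1.length_nodup P hP).1]
  · intro U B V hL x y hxy hB
    obtain ⟨j, X, D, Y, S₁, P, S₂, D₁, a, D₂, hj, rfl, rfl, rfl, hl, rfl, rfl, rfl⟩ :=
      distributeFrom_eq_append_cons hlen hL
    have hDm := h2.length_nodup (D₁ ++ a :: D₂) (by simp)
    have hl2 : D₂.length = S₂.length := by
      have := hDm.1
      simp only [List.length_append, List.length_cons] at this
      omega
    have hX : ∀ b, Nat.pair (j + 1) b ∉ (distributeFrom (S₁ ++ P :: S₂) 0 X).flatten :=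
      fun b h => by have := lt_of_pair_succ_mem_distributeFrom h; omega
    have hY : ∀ b, Nat.pair (j + 1) b ∉ (distributeFrom (S₁ ++ P :: S₂) (j + 1) Y).flatten :=
      fun b h => by have := lt_of_pair_succ_mem_distributeFrom h; omega
    rw [List.flatten_append, List.flatten_append]
    have hfil : ∀ b, inClass (j + 1) (Nat.pair (j + 1) b) := by simp [inClass_pair]
    -- Either both symbols belong to copy `j`, and filtering reduces to `outside` for `S'`; or y is
    -- the appended symbol, and x lives only in copy `j`, where y occurs in no other block.
    by_cases hyP : y ∈ P.map (Nat.pair (j + 1))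
    · have hyP' : y ∉ [Nat.pair 0 a] := by
        obtain ⟨b, -, rfl⟩ := List.mem_map.1 hyP
        simp [Nat.pair_eq_pair]
      have hB' := pair_sublist_of_append_right hyP' hB
      obtain ⟨x', -, rfl⟩ := List.mem_map.1 (hB'.subset (by simp : x ∈ [x, y]))
      obtain ⟨y', -, rfl⟩ := List.mem_map.1 hyP
      rw [pair_sublist_map_pair] at hB'
      obtain ⟨h3, h4⟩ := h1.outside S₁ P S₂ rfl x' y' (fun e => hxy (by rw [e])) hB'
      constructor
      · intro h
        have := (pair_sublist_filter (hfil x') (hfil y')).2 (pair_sublist_of_append_left (hX x') h)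
        rw [filter_succ_distributeBlock j hl, pair_sublist_map_pair] at this
        exact h3 this
      · intro h
        have := (pair_sublist_filter (hfil y') (hfil x')).2
          (pair_sublist_of_append_right (hY x') h)
        rw [filter_succ_distributeBlock j hl2, pair_sublist_map_pair] at this
        exact h4 this
    · obtain rfl : y = Nat.pair 0 a := by
        have := hB.subset (by simp : y ∈ [x, y])
        simpa [hyP] using (List.mem_append.1 this).resolve_left hyP
      have hx := hB.subset (by simp : x ∈ [x, Nat.pair 0 a])
      rw [List.mem_append, List.mem_singleton] at hx
      obtain ⟨x', -, rfl⟩ := List.mem_map.1 (hx.resolve_right hxy)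
      have hnd := hDm.2
      rw [List.nodup_append, List.nodup_cons] at hnd
      constructor
      · intro h
        have := (pair_sublist_of_append_left (hX x') h).subset
          (by simp : Nat.pair 0 a ∈ [Nat.pair (j + 1) x', Nat.pair 0 a])
        exact hnd.2.2 a (mem_of_pair_zero_mem_distributeBlock this) a (by simp) rfl
      · intro h
        have := (pair_sublist_of_append_right (hY x') h).subset
          (by simp : Nat.pair 0 a ∈ [Nat.pair 0 a, Nat.pair (j + 1) x'])
        exact hnd.2.1.1 (mem_of_pair_zero_mem_distributeBlock this)

/-! ### The sequences `S^s_k(m)` satisfy the invariants -/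

theorem mu_pos (s k : ℕ) : 0 < mu s k := by
  induction k generalizing s with
  | zero => rw [mu]; split_ifs <;> simp
  | succ k ih =>
    rw [mu]; split_ifs
    · simp
    · exact Nat.mul_pos (ih _) (ih _)

/-- For m ≥ 2 both blocks contain the same pairs, so `IsPositional` fails. This is harmless: order 2
enters the recursion only as `Sbar`, for which `IsUniform` suffices. -/
theorem isUniform_range'_reverse (m : ℕ) :
    IsUniform 2 2 m [List.range' 1 m, (List.range' 1 m).reverse] := by
  refine ⟨by simp, ?_, ?_, ?_⟩
  · simp [List.nodup_range']
  · intro a b _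
    simpa using altLength_append_reverse_of_nodup a b (List.nodup_range' (s := 1) (n := m))
  · intro a ha
    have ha' : a ∈ List.range' 1 m := by simpa using ha
    simp [List.count_eq_one_of_mem List.nodup_range' ha']

theorem isPositional_range' {s : ℕ} (hs : 1 ≤ s) (m : ℕ) :
    IsPositional s 1 m [List.range' 1 m] := by
  refine ⟨⟨by simp, ?_, ?_, ?_⟩, ⟨(List.range' 1 m).idxOf, by simp⟩, ?_⟩
  · simp [List.nodup_range']
  · intro a b _
    have := altLength_le_two_of_nodup a b (List.nodup_range' (s := 1) (n := m))
    simp only [List.flatten_cons, List.flatten_nil, List.append_nil]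
    omega
  · intro a ha
    have ha' : a ∈ List.range' 1 m := by simpa using ha
    simp [List.count_eq_one_of_mem List.nodup_range' ha']
  · intro U B V h x y _ _
    obtain ⟨rfl, rfl⟩ : U = [] ∧ V = [] := by
      have := congrArg List.length h
      simp only [List.length_append, List.length_cons, List.length_nil] at this
      exact ⟨List.length_eq_zero_iff.1 (by omega), List.length_eq_zero_iff.1 (by omega)⟩
    simp

theorem isPositional_replicate {s μ : ℕ} (hμ : 0 < μ) :
    IsPositional s μ 1 (List.replicate μ [1]) := by
  have e : (List.replicate μ [1]).flatten = List.replicate μ 1 := by simp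
  refine ⟨⟨by simp; omega, ?_, ?_, ?_⟩, ⟨fun _ => 0, ?_⟩, ?_⟩
  · intro B hB
    simp [List.eq_of_mem_replicate hB]
  · intro a b hab
    rw [e]
    by_cases ha : a = 1
    · rw [altLength_of_notMem_right fun hb => hab (ha.trans (List.eq_of_mem_replicate hb).symm)]
      split_ifs <;> omega
    · rw [altLength_of_notMem_left fun h => ha (List.eq_of_mem_replicate h)]
      omega
  · intro a ha
    rw [e] at ha ⊢
    rw [List.eq_of_mem_replicate ha, List.count_replicate_self]
  · intro B hB a ha
    rw [List.eq_of_mem_replicate hB] at ha ⊢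
    simp_all
  · intro U B V h x y hxy hB
    have : B ∈ List.replicate μ [1] := by simp [h]
    rw [List.eq_of_mem_replicate this] at hB
    have := hB.length_le
    simp at this

theorem numSymbols_pos {s μ m : ℕ} {L : List (List ℕ)} (h : IsUniform s μ m L) (hm : 1 ≤ m) :
    1 ≤ numSymbols L.flatten := by
  obtain ⟨B, hB⟩ := List.exists_mem_of_ne_nil _ h.ne_nil
  have := (h.length_nodup B hB).1
  obtain ⟨a, ha⟩ := List.exists_mem_of_length_pos (by omega : 0 < B.length)
  exact Finset.card_pos.2 ⟨a, List.mem_toFinset.2 (List.mem_flatten_of_mem hB ha)⟩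

theorem IsPositional.of_buildRow {s μ₁ μ₂ : ℕ} (hs : Even s) (hs2 : 2 ≤ s)
    (hμ : 0 < μ₁ * μ₂) {Slow Sprev : ℕ → List (List ℕ)}
    (h1 : ∀ m, 1 ≤ m → IsUniform s μ₁ m (Slow m))
    (h2 : ∀ m, 1 ≤ m → IsPositional (s + 2) μ₂ m (Sprev m)) (m : ℕ) (hm : 1 ≤ m) :
    IsPositional (s + 2) (μ₁ * μ₂) m (buildRow (μ₁ * μ₂) Slow Sprev m) := by
  induction m, hm using Nat.le_induction with
  | base => exact isPositional_replicate hμ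
  | succ m hm ih =>
    obtain ⟨m, rfl⟩ := Nat.exists_eq_add_of_le' hm
    rw [buildRow]
    have hf := h1 _ (List.length_pos_iff.2 ih.ne_nil)
    exact ih.of_distribute (by omega)
      (hf.of_replaceBlocks hs (h2 _ (numSymbols_pos hf (List.length_pos_iff.2 ih.ne_nil))))

theorem isUniform_and_isPositional_blocks (k s : ℕ) (hs : Even s) (hs2 : 2 ≤ s) (m : ℕ)
    (hm : 1 ≤ m) : IsUniform s (mu s k) m (blocks s k m) ∧
      (4 ≤ s → IsPositional s (mu s k) m (blocks s k m)) := by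
  induction k generalizing s m with
  | zero =>
    rw [blocks, blocksAux, mu]
    split_ifs with h
    · obtain rfl : s = 2 := by omega
      exact ⟨isUniform_range'_reverse m, by omega⟩
    · have := isPositional_range' (s := s) (by omega) m
      exact ⟨this.toIsUniform, fun _ => this⟩
  | succ k ih =>
    rw [blocks, blocksAux, mu]
    split_ifs with h
    · obtain rfl : s = 2 := by omega
      exact ⟨isUniform_range'_reverse m, by omega⟩
    · obtain ⟨s, rfl⟩ := Nat.exists_eq_add_of_le' hs2
      have hs' : Even s := by simpa [Nat.even_add] using hs
      have h2 : 2 ≤ s := by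
        rw [Nat.even_iff] at hs'; omega
      rw [Nat.add_sub_cancel]
      have := IsPositional.of_buildRow hs' h2 (Nat.mul_pos (mu_pos s k) (mu_pos (s + 2) k))
        (fun m hm => (ih s hs' h2 m hm).1)
        (fun m hm => (ih (s + 2) hs (by omega) m hm).2 (by omega)) m hm
      exact ⟨this.toIsUniform, fun _ => this⟩

theorem isPositional_blocks {s : ℕ} (hs : Even s) (h4 : 4 ≤ s) (k : ℕ) {m : ℕ} (hm : 1 ≤ m) :
    IsPositional s (mu s k) m (blocks s k m) :=
  (isUniform_and_isPositional_blocks k s hs (by omega) m hm).2 h4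

theorem IsPositional.pairwise {s μ m : ℕ} {L : List (List ℕ)} (h : IsPositional s μ m L) :
    L.Pairwise fun B B' => ∀ a b : ℕ, a ∈ B → b ∈ B → a ∈ B' → b ∈ B' → a = b := by
  suffices ∀ U V, L = U ++ V →
      V.Pairwise fun B B' => ∀ a b : ℕ, a ∈ B → b ∈ B → a ∈ B' → b ∈ B' → a = b from
    this [] L rfl
  intro U V
  induction V generalizing U with
  | nil => simp
  | cons B V ih =>
    intro hL
    refine List.pairwise_cons.2 ⟨?_, ih (U ++ [B]) (by simp [hL])⟩
    intro B' hB' a b ha hb ha' hb'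
    by_contra hab
    exact h.not_mem_both hL hB' hab ⟨ha, hb⟩ ⟨ha', hb'⟩

/-- A repetition across a block boundary would put one symbol both at position `m - 1` and at
position 0. -/
theorem IsPositional.isDavenportSchinzel {s μ m : ℕ} {L : List (List ℕ)}
    (h : IsPositional s μ m L) (hm : 2 ≤ m) : IsDavenportSchinzel s L.flatten := by
  refine ⟨?_, avoidsAlternation_iff.2 h.altLength_le⟩
  obtain ⟨pos, hpos⟩ := h.position
  have hl := h.length_nodup
  rw [List.isChain_flatten (fun hn => by have := (hl [] hn).1; simp at this; omega)]
  refine ⟨fun B hB => List.Pairwise.isChain (hl B hB).2, ?_⟩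
  refine List.Pairwise.isChain (List.pairwise_of_forall_mem_list ?_)
  rintro B hB B' hB' x hx y hy rfl
  have hxB := List.mem_of_getLast? hx
  have hxB' := List.mem_of_head? hy
  have e := (hpos B hB x hxB).trans (hpos B' hB' x hxB').symm
  rcases B' with _ | ⟨z, B'⟩
  · simp at hxB'
  simp only [List.head?_cons, Option.mem_def, Option.some.injEq] at hy
  subst hy
  rw [List.idxOf_cons_self] at e
  have hne : B ≠ [] := List.ne_nil_of_mem hxB
  rw [Option.mem_def, List.getLast?_eq_some_getLast hne, Option.some.injEq] at hx
  rw [← hx, List.getLast_eq_getElem, List.Nodup.idxOf_getElem (hl B hB).2, (hl B hB).1] at e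
  omega

/-- Lowering the order by 2 lowers `t` by 1, so the recursion is Pascal's rule in the exponent. -/
theorem mu_eq (k t : ℕ) : mu (2 * (t + 1)) k = 2 ^ k.choose t := by
  induction k generalizing t with
  | zero =>
    rw [mu]
    rcases t with _ | t
    · simp
    · rw [if_neg (by omega)]; simp
  | succ k ih =>
    rw [mu]
    rcases t with _ | t
    · simp
    · rw [if_neg (by omega), show 2 * (t + 1 + 1) - 2 = 2 * (t + 1) by omega, ih, ih,
        Nat.choose_succ_succ, pow_add]

/-! ### The Ackermann hierarchy -/

theorem ackHier_zero (k : ℕ) : ackHier (k + 2) 0 = 1 := rfl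

theorem ackHier_add (k n j : ℕ) :
    ackHier (k + 2) (n + j) = (ackHier (k + 1))^[j] (ackHier (k + 2) n) := by
  rw [add_comm n j]
  exact Function.iterate_add_apply _ _ _ _

theorem ackHier_succ (k n : ℕ) :
    ackHier (k + 2) (n + 1) = ackHier (k + 1) (ackHier (k + 2) n) :=
  ackHier_add k n 1

theorem two_mul_le_ackHier (k n : ℕ) : 2 * n ≤ ackHier (k + 1) n := by
  induction k generalizing n with
  | zero => exact le_rfl
  | succ k ih =>
    have h : ∀ n, 2 ^ n ≤ ackHier (k + 2) n := by
      intro n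
      induction n with
      | zero => exact le_rfl
      | succ n ihn =>
        rw [ackHier_succ]
        have := ih (ackHier (k + 2) n)
        rw [pow_succ]
        omega
    refine le_trans ?_ (h n)
    rcases n with _ | n
    · simp
    · have := (Nat.lt_two_pow_self : n < 2 ^ n)
      rw [pow_succ]; omega

theorem two_pow_le_ackHier (k n : ℕ) : 2 ^ n ≤ ackHier (k + 2) n := by
  induction n with
  | zero => exact le_rfl
  | succ n ih =>
    rw [ackHier_succ]
    have := two_mul_le_ackHier k (ackHier (k + 2) n)
    rw [pow_succ]
    omega

theorem two_mul_ackHier_le (k n : ℕ) : 2 * ackHier (k + 2) n ≤ ackHier (k + 2) (n + 1) := by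
  rw [ackHier_succ]
  exact two_mul_le_ackHier k _

theorem ackHier_monotone (k : ℕ) : Monotone (ackHier (k + 2)) := by
  apply monotone_nat_of_le_succ
  intro n
  have := two_mul_ackHier_le k n
  omega

theorem ackHier_one (k : ℕ) : ackHier (k + 1) 1 = 2 := by
  induction k with
  | zero => rfl
  | succ k ih => rw [ackHier_succ, ackHier_zero, ih]

theorem ackHier_two (k : ℕ) : ackHier (k + 1) 2 = 4 := by
  induction k with
  | zero => rfl
  | succ k ih => rw [ackHier_succ, ackHier_one, ih]

/-- Every level takes the value 4 at 2, so the value at 3 is that of the preceding level at 4. -/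
theorem ackHier_three (k : ℕ) : ackHier (k + 2) 3 = ackHier (k + 1) 4 := by
  rw [ackHier_succ, ackHier_two]

theorem ackHier_four (k : ℕ) : ackHier (k + 2) 4 = ackHier (k + 1) (ackHier (k + 1) 4) := by
  rw [ackHier_succ, ackHier_three]

theorem two_pow_succ_le_ackHier_four (k : ℕ) : 2 ^ (k + 1) ≤ ackHier (k + 2) 4 := by
  induction k with
  | zero => exact le_trans (by norm_num) (two_pow_le_ackHier 0 4)
  | succ k ih =>
    rw [ackHier_four]
    refine le_trans ?_ (two_pow_le_ackHier _ _)
    exact Nat.pow_le_pow_right (by norm_num) (le_trans (Nat.lt_two_pow_self) ih)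

theorem le_ack (n : ℕ) : n ≤ ack (n + 3) := by
  rw [ack, ackHier_three]
  have : 2 ^ (n + 1) ≤ ackHier (n + 1 + 1) 4 := two_pow_succ_le_ackHier_four n
  have := (Nat.lt_two_pow_self : n + 1 < 2 ^ (n + 1))
  omega

theorem invAck_le {n j : ℕ} (hj : 1 ≤ j) (h : n ≤ ack j) : invAck n ≤ j := Nat.sInf_le ⟨hj, h⟩

/-- The set must be shown nonempty, as `sInf ∅ = 0`; `le_ack` provides an element. -/
theorem one_le_invAck (n : ℕ) : 1 ≤ invAck n :=
  (Nat.sInf_mem (s := {j | 1 ≤ j ∧ n ≤ ack j}) ⟨n + 3, by omega, le_ack n⟩).1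

/-! ### Number of symbols of `S^s_k(2)` -/

theorem cube_le_two_pow {x : ℕ} (hx : 16 ≤ x) : x ^ 3 ≤ 2 ^ x := by
  induction x, hx using Nat.le_induction with
  | base => norm_num
  | succ x hx ih =>
    rw [pow_succ 2]
    have : 16 * x ^ 2 ≤ x ^ 3 := by rw [pow_succ x 2, mul_comm]; gcongr
    nlinarith

/-- Here `f`, `p`, `q` stand for the numbers of blocks of S', of S̄ and of S*, and `g` for the
number of symbols of S̄. One application of `E` absorbs x ↦ 8x+8 or a cube once x ≥ 16. Thus p, g, q
lie below the iterates 2, 3, 5 of `E` at `a`, and the product below the sixth; eight leaves room. -/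
theorem mul_mul_le_iterate {E : ℕ → ℕ} (hE : Monotone E) (hpow : ∀ x, 2 ^ x ≤ E x)
    {a f g p q : ℕ} (ha : 16 ≤ a) (hf : f ≤ a) (hp : p ≤ E (8 * f + 8)) (hg : g ≤ f * p)
    (hq : q ≤ E (8 * g + 8)) : q * p * f ≤ E^[8] a := by
  have cube : ∀ x, 16 ≤ x → x ^ 3 ≤ E x := fun x hx => (cube_le_two_pow hx).trans (hpow x)
  have lin : ∀ x, 16 ≤ x → 8 * x + 8 ≤ E x := fun x hx =>
    le_trans (by nlinarith [sq_nonneg x, Nat.mul_le_mul hx hx]) (cube x hx)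
  have hsq : ∀ x, 16 ≤ x → x * x ≤ E x := fun x hx =>
    le_trans (by rw [pow_succ, sq]; exact Nat.le_mul_of_pos_right _ (by omega)) (cube x hx)
  have ge : ∀ x, 16 ≤ x → x ≤ E x := fun x hx => by have := lin x hx; omega
  have h1 := ge a ha
  have h2 := ge (E a) (by omega)
  have h3 := ge (E (E a)) (by omega)
  have h4 := ge (E (E (E a))) (by omega)
  have h5 := ge (E (E (E (E a)))) (by omega)
  have h6 := ge (E (E (E (E (E a))))) (by omega)
  have h7 := ge (E (E (E (E (E (E a)))))) (by omega)
  have h8 := ge (E (E (E (E (E (E (E a))))))) (by omega)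
  have hp' : p ≤ E (E a) := hp.trans (hE (le_trans (by omega) (lin a ha)))
  have hg' : g ≤ E (E (E a)) :=
    hg.trans ((Nat.mul_le_mul (by omega) hp').trans (hsq (E (E a)) (by omega)))
  have hq' : q ≤ E (E (E (E (E a)))) :=
    hq.trans (hE (le_trans (by omega) (lin (E (E (E a))) (by omega))))
  have : q * p * f ≤ E (E (E (E (E a)))) ^ 3 := by
    rw [pow_succ, sq]
    exact Nat.mul_le_mul (Nat.mul_le_mul hq' (by omega)) (by omega)
  have := this.trans (cube _ (by omega))
  simp only [Function.iterate_succ, Function.iterate_zero, Function.comp, id]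
  omega

theorem IsUniform.length_flatten {s μ m : ℕ} {L : List (List ℕ)} (h : IsUniform s μ m L) :
    L.flatten.length = L.length * m := by
  rw [List.length_flatten, List.sum_eq_card_nsmul _ m]
  · simp
  · intro x hx
    obtain ⟨B, hB, rfl⟩ := List.mem_map.1 hx
    exact (h.length_nodup B hB).1

theorem IsUniform.numSymbols_mul {s μ m : ℕ} {L : List (List ℕ)} (h : IsUniform s μ m L) :
    numSymbols L.flatten * μ = L.flatten.length := by
  rw [← List.sum_toFinset_count_eq_length, numSymbols,
    Finset.sum_const_nat fun a ha => ?_]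
  convert h.count_eq a (List.mem_toFinset.1 ha)

theorem IsUniform.numSymbols_le {s μ m : ℕ} {L : List (List ℕ)} (h : IsUniform s μ m L) :
    numSymbols L.flatten ≤ L.length * m := by
  rw [← h.length_flatten]
  exact List.toFinset_card_le _

theorem mu_le (s k : ℕ) : mu s k ≤ 2 ^ 2 ^ k := by
  induction k generalizing s with
  | zero => rw [mu]; split_ifs <;> simp
  | succ k ih =>
    rw [mu]
    split_ifs
    · exact Nat.le_self_pow (by positivity) 2
    · rw [pow_succ 2 k, mul_two, pow_add]
      exact Nat.mul_le_mul (ih _) (ih _)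

theorem length_blocks_le (k s : ℕ) (hs : Even s) (hs2 : 2 ≤ s) (m : ℕ) (hm : 1 ≤ m) :
    (blocks s k m).length ≤ ackHier (k + 3) (8 * m + 8) := by
  have h16 : ∀ k m, 1 ≤ m → 2 ^ 16 ≤ ackHier (k + 3) (8 * m + 8) := fun k m hm =>
    (Nat.pow_le_pow_right (by norm_num) (by omega)).trans (two_pow_le_ackHier (k + 1) (8 * m + 8))
  induction k generalizing s m with
  | zero =>
    have := h16 0 m hm
    rw [blocks, blocksAux]
    split_ifs <;> simp only [List.length_cons, List.length_nil] <;> omega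
  | succ k ih =>
    by_cases h : s ≤ 2
    · have := h16 (k + 1) m hm
      rw [blocks, blocksAux, if_pos h]
      simp only [List.length_cons, List.length_nil]; omega
    · induction m, hm using Nat.le_induction with
      | base =>
        rw [blocks, blocksAux, if_neg h, buildRow, List.length_replicate]
        -- Passing to the next Ackermann level at 4 absorbs one exponential.
        calc mu s (k + 1) ≤ 2 ^ 2 ^ (k + 1) := mu_le _ _
          _ ≤ 2 ^ ackHier (k + 2) 4 :=
            Nat.pow_le_pow_right (by norm_num) (two_pow_succ_le_ackHier_four k)
          _ ≤ ackHier (k + 1 + 2) 4 := by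
            rw [ackHier_four (k + 1)]; exact two_pow_le_ackHier _ _
          _ ≤ ackHier (k + 2 + 2) 4 := by
            rw [ackHier_four (k + 1 + 1)]
            exact ackHier_monotone _ (le_trans (by norm_num) (two_mul_le_ackHier (k + 2) 4))
          _ ≤ _ := ackHier_monotone _ (by norm_num)
      | succ m hm ihm =>
        obtain ⟨r, rfl⟩ := Nat.exists_eq_add_of_le' hs2
        have hr : Even r := by simpa [Nat.even_add] using hs
        have hr2 : 2 ≤ r := by rw [Nat.even_iff] at hr; omega
        have hS' := isPositional_blocks hs (by omega) (k + 1) hm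
        set S' := blocks (r + 2) (k + 1) m with hS'def
        have hf : 1 ≤ S'.length := List.length_pos_iff.2 hS'.ne_nil
        have hbar := (isUniform_and_isPositional_blocks k r hr hr2 S'.length hf).1
        set Sbar := blocks r k S'.length with hSbardef
        have hg := numSymbols_pos hbar hf
        have hstar := isPositional_blocks hs (by omega) k hg
        set Sstar := blocks (r + 2) k (numSymbols Sbar.flatten) with hSstardef
        have e : blocks (r + 2) (k + 1) (m + 1) = distribute S' (replaceBlocks Sbar Sstar) := by
          obtain ⟨m, rfl⟩ := Nat.exists_eq_add_of_le' hm
          rw [hSstardef, hSbardef, hS'def]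
          simp only [blocks, blocksAux, if_neg h, buildRow, Nat.add_sub_cancel]
        rw [e, distribute_eq, length_distributeFrom 0 fun D hD =>
          ((hbar.of_replaceBlocks hr hstar).length_nodup D hD).1, length_replaceBlocks]
        have key := mul_mul_le_iterate (ackHier_monotone (k + 1)) (two_pow_le_ackHier (k + 1))
          (a := ackHier (k + 1 + 3) (8 * m + 8))
          (((by omega : 16 ≤ 8 * m + 8).trans Nat.lt_two_pow_self.le).trans
            (two_pow_le_ackHier (k + 2) _))
          ihm (ih r hr hr2 S'.length hf) (hbar.numSymbols_le.trans (mul_comm _ _).le)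
          (ih (r + 2) hs (by omega) _ hg)
        refine key.trans (le_of_eq ?_)
        -- The slope 8 of the argument matches the eight applications of the lower level.
        rw [show 8 * (m + 1) + 8 = 8 * m + 8 + 8 by ring]
        exact (ackHier_add (k + 2) (8 * m + 8) 8).symm

theorem numSymbols_seq_le {s : ℕ} (hs : Even s) (h4 : 4 ≤ s) (k : ℕ) :
    numSymbols (seq s k 2) ≤ ack (k + 5) := by
  have h1 := (isPositional_blocks hs h4 k one_le_two).numSymbols_le
  have h2 := length_blocks_le k s hs (by omega) 2 (by norm_num)
  have h3 : 2 * ackHier (k + 3) (8 * 2 + 8) ≤ ackHier (k + 3) (8 * 2 + 8 + 1) :=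
    two_mul_ackHier_le (k + 1) (8 * 2 + 8)
  have h5 : 8 * 2 + 8 + 1 ≤ ackHier (k + 3) 4 := by
    rw [ackHier_four (k + 1)]
    refine le_trans ?_ (two_pow_le_ackHier k _)
    refine le_trans ?_ (Nat.pow_le_pow_right (by norm_num) (two_mul_le_ackHier (k + 1) 4))
    norm_num
  rw [ack, ackHier_three, ackHier_four]
  have h6 : ackHier (k + 3) (8 * 2 + 8 + 1) ≤ ackHier (k + 3) (ackHier (k + 3) 4) :=
    ackHier_monotone (k + 1) h5
  change numSymbols (blocks s k 2).flatten ≤ ackHier (k + 3) (ackHier (k + 3) 4)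
  omega

/-! ### Lower bounds for `λ_s(n)` -/

theorem le_lambda {s : ℕ} (hs : 1 ≤ s) {S : List ℕ} (h : IsDavenportSchinzel s S) :
    S.length ≤ lambda s (numSymbols S) :=
  (isGreatest_lambda hs).2 ⟨S, h, rfl, rfl⟩

theorem self_le_lambda {s : ℕ} (hs : 1 ≤ s) (n : ℕ) : n ≤ lambda s n :=
  (isGreatest_lambda hs).2 ⟨List.range n, ⟨List.Pairwise.isChain List.nodup_range,
    fun _ _ _ => alternation_not_sublist_range (by omega)⟩,
    by rw [numSymbols, List.toFinset_card_of_nodup List.nodup_range, List.length_range],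
    List.length_range⟩

theorem IsDavenportSchinzel.append {s : ℕ} (hs : 1 ≤ s) {S T : List ℕ}
    (hS : IsDavenportSchinzel s S) (hT : IsDavenportSchinzel s T) (hd : ∀ a ∈ S, a ∉ T) :
    IsDavenportSchinzel s (S ++ T) := by
  refine ⟨List.isChain_append.2 ⟨hS.1, hT.1, ?_⟩, avoidsAlternation_iff.2 ?_⟩
  · rintro x hx y hy rfl
    exact hd x (List.mem_of_getLast? hx) (List.mem_of_head? hy)
  · intro a b hab
    have h1 := avoidsAlternation_iff.1 hS.2 a b hab
    have h2 := avoidsAlternation_iff.1 hT.2 a b hab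
    by_cases haS : a ∈ S <;> by_cases hbS : b ∈ S
    · rw [altLength_append, altLength_of_notMem_left (hd a haS), altLength_of_notMem_left (hd b hbS)]
      simpa using h1
    · have := (altLength_append_of_notMem hbS (hd a haS)).1
      omega
    · have := (altLength_append_of_notMem haS (hd b hbS)).2
      omega
    · rw [altLength_append, altLength_of_notMem_left haS]
      simpa using h2

theorem IsDavenportSchinzel.map {s : ℕ} {f : ℕ → ℕ} (hf : Function.Injective f) {S : List ℕ}
    (hS : IsDavenportSchinzel s S) : IsDavenportSchinzel s (S.map f) := by
  refine ⟨?_, avoidsAlternation_iff.2 ?_⟩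
  · rw [List.isChain_map]
    exact hS.1.imp fun _ _ h e => h (hf e)
  · intro a b hab
    by_cases ha : a ∈ S.map f
    · by_cases hb : b ∈ S.map f
      · obtain ⟨a, -, rfl⟩ := List.mem_map.1 ha
        obtain ⟨b, -, rfl⟩ := List.mem_map.1 hb
        rw [altLength_map_of_injective hf]
        exact avoidsAlternation_iff.1 hS.2 a b fun e => hab (by rw [e])
      · rw [altLength_of_notMem_right hb]; (split_ifs; omega)
    · rw [altLength_of_notMem_left ha]; omega

theorem numSymbols_map {f : ℕ → ℕ} (hf : Function.Injective f) (S : List ℕ) :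
    numSymbols (S.map f) = numSymbols S := by
  rw [numSymbols, numSymbols, ← Finset.card_image_of_injective S.toFinset hf]
  congr 1
  ext
  simp

theorem lambda_add_le {s : ℕ} (hs : 1 ≤ s) (m n : ℕ) :
    lambda s m + lambda s n ≤ lambda s (m + n) := by
  obtain ⟨S, hS, hSm, hSl⟩ := (isGreatest_lambda (n := m) hs).1
  obtain ⟨T, hT, hTn, hTl⟩ := (isGreatest_lambda (n := n) hs).1
  have h2 : Function.Injective (fun x : ℕ => 2 * x) := fun x y h => by simp at h; omega
  have h3 : Function.Injective (fun x : ℕ => 2 * x + 1) := fun x y h => by simp at h; omega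
  have hd : ∀ a ∈ S.map fun x => 2 * x, a ∉ T.map fun x => 2 * x + 1 := by
    intro a ha hb
    obtain ⟨x, -, rfl⟩ := List.mem_map.1 ha
    obtain ⟨y, -, h⟩ := List.mem_map.1 hb
    omega
  refine (isGreatest_lambda hs).2 ⟨_, (hS.map h2).append hs (hT.map h3) hd, ?_, ?_⟩
  · rw [numSymbols, List.toFinset_append, Finset.card_union_of_disjoint, ← hSm, ← hTn, numSymbols,
      numSymbols]
    · congr 1
      · exact numSymbols_map h2 S
      · exact numSymbols_map h3 T
    · rw [Finset.disjoint_left]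
      intro a ha hb
      exact hd a (List.mem_toFinset.1 ha) (List.mem_toFinset.1 hb)
  · rw [List.length_append, List.length_map, List.length_map, hSl, hTl]

theorem mul_lambda_le {s : ℕ} (hs : 1 ≤ s) (q n : ℕ) : q * lambda s n ≤ lambda s (q * n) := by
  induction q with
  | zero => simp
  | succ q ih =>
    rw [add_mul, add_mul, one_mul, one_mul]
    exact (Nat.add_le_add_right ih _).trans (lambda_add_le hs _ _)

/-- Superadditivity gives `n / N` disjoint copies of an extremal sequence, and these use at least
half of the `n` symbols. -/
theorem mul_le_two_mul_lambda {s : ℕ} (hs : 1 ≤ s) {n N c : ℕ} (hN : 1 ≤ N) (hn : N ≤ n)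
    (h : N * c ≤ lambda s N) : n * c ≤ 2 * lambda s n := by
  have hq : 1 ≤ n / N := (Nat.one_le_div_iff hN).2 hn
  have hr := Nat.mod_lt n hN
  have hdiv := Nat.div_add_mod n N
  have h1 : n ≤ 2 * (n / N * N) := by
    have : N ≤ n / N * N := Nat.le_mul_of_pos_left N hq
    rw [mul_comm] at hdiv
    omega
  have h2 : n / N * lambda s N ≤ lambda s n := by
    refine (mul_lambda_le hs _ _).trans ?_
    have := lambda_add_le hs (n / N * N) (n % N)
    rw [mul_comm (n / N) N, hdiv] at this
    rw [mul_comm (n / N) N]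
    omega
  calc n * c ≤ 2 * (n / N * N) * c := Nat.mul_le_mul_right _ h1
    _ = 2 * (n / N * (N * c)) := by ring
    _ ≤ 2 * (n / N * lambda s N) := by gcongr
    _ ≤ _ := by gcongr

theorem numSymbols_seq_mul {s : ℕ} (hs : Even s) (h4 : 4 ≤ s) (k : ℕ) :
    numSymbols (seq s k 2) * mu s k = (seq s k 2).length :=
  (isPositional_blocks hs h4 k one_le_two).numSymbols_mul

/-- Take the first index with n_k > n: it bounds α(n) by k+5, while its predecessor has at most n
symbols and can be repeated. The shift by one index gives the 6. -/
theorem exists_mul_mu_le_two_mul_lambda {s : ℕ} (hs : Even s) (h4 : 4 ≤ s) (n : ℕ) :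
    ∃ k, invAck n ≤ k + 6 ∧ n * mu s k ≤ 2 * lambda s n := by
  have hfrom : ∀ k, numSymbols (seq s k 2) ≤ n → n * mu s k ≤ 2 * lambda s n := by
    intro k hk
    have hpos := isPositional_blocks hs h4 k one_le_two
    refine mul_le_two_mul_lambda (by omega) (numSymbols_pos hpos.toIsUniform one_le_two) hk ?_
    exact (numSymbols_seq_mul hs h4 k).trans_le
      (le_lambda (by omega) (hpos.isDavenportSchinzel le_rfl))
  by_cases hex : ∃ k, n < numSymbols (seq s k 2)
  · classical
    have hk := Nat.find_spec hex
    have hmin := fun j => Nat.find_min (m := j) hex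
    generalize Nat.find hex = k at hk hmin
    have hα : invAck n ≤ k + 5 :=
      invAck_le (by omega) (hk.le.trans (numSymbols_seq_le hs h4 k))
    rcases k with _ | k
    · refine ⟨0, by omega, ?_⟩
      rw [mu, if_neg (by omega), mul_one]
      have := self_le_lambda (s := s) (by omega) n
      omega
    · exact ⟨k, by omega, hfrom k (not_lt.1 (hmin k (Nat.lt_succ_self k)))⟩
  -- If every n_k were at most n, any k would do, so unboundedness of n_k is not needed.
  · push Not at hex
    exact ⟨invAck n, by omega, hfrom _ (hex _)⟩

/-! ### Comparing the binomial exponent with a power of α -/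

theorem pow_sub_le_sub_pow {x d : ℝ} (hd : 0 ≤ d) (hx : d ≤ x) (t : ℕ) :
    x ^ (t + 1) - (t + 1) * d * x ^ t ≤ (x - d) ^ (t + 1) := by
  induction t with
  | zero => simp
  | succ t ih =>
    have h := mul_le_mul_of_nonneg_right ih (sub_nonneg.2 hx)
    rw [← pow_succ] at h
    have hnn : 0 ≤ (t + 1) * d * x ^ t * d := by
      have := hd.trans hx
      positivity
    refine le_trans ?_ h
    push_cast
    have e : x ^ (t + 1) = x ^ t * x := pow_succ _ _
    have e' : x ^ (t + 1 + 1) = x ^ t * x * x := by rw [pow_succ, pow_succ]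
    rw [e', e]
    linarith

/-- Bound (t+1)!·binom(k,t+1), a falling factorial, below by (α-c-t-1)^{t+1} and apply Bernoulli.
The factor t+1 of the error term disappears on division by (t+1)!. For smaller α the left side
without the final correction is nonpositive. -/
theorem exponent_le_choose {α k c t : ℕ} (hα : 1 ≤ α) (h : α ≤ k + c) :
    (1 / ((t + 1)! : ℝ)) * (α : ℝ) ^ (t + 1) - ((c + t + 2 : ℕ) : ℝ) * (α : ℝ) ^ t ≤
      (k.choose (t + 1) : ℝ) - 1 := by
  have hα' : (1 : ℝ) ≤ α := by exact_mod_cast hα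
  have hpow : (1 : ℝ) ≤ (α : ℝ) ^ t := one_le_pow₀ hα'
  have hfac : (1 : ℝ) ≤ ((t + 1)! : ℝ) := by exact_mod_cast Nat.succ_le_of_lt (Nat.factorial_pos _)
  have hfac' : 1 / ((t + 1)! : ℝ) ≤ 1 := by
    rw [div_le_one (by linarith)]; exact hfac
  -- The subtracted 1, which pays for the lost factor 2, is covered by one extra α^t ≥ 1.
  suffices (1 / ((t + 1)! : ℝ)) * (α : ℝ) ^ (t + 1) - ((c + t + 1 : ℕ) : ℝ) * (α : ℝ) ^ t ≤
      (k.choose (t + 1) : ℝ) by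
    push_cast at this ⊢
    nlinarith
  rcases le_total α (c + t + 1) with hle | hle
  · have h1 : (α : ℝ) ≤ ((c + t + 1 : ℕ) : ℝ) := by exact_mod_cast hle
    have h2 : (1 / ((t + 1)! : ℝ)) * (α : ℝ) ^ (t + 1) ≤ ((c + t + 1 : ℕ) : ℝ) * (α : ℝ) ^ t :=
      calc (1 / ((t + 1)! : ℝ)) * (α : ℝ) ^ (t + 1) ≤ 1 * (α : ℝ) ^ (t + 1) := by gcongr
        _ = (α : ℝ) * (α : ℝ) ^ t := by rw [one_mul, pow_succ, mul_comm]
        _ ≤ _ := by gcongr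
    have h3 : (0 : ℝ) ≤ (k.choose (t + 1) : ℝ) := Nat.cast_nonneg _
    linarith
  · have h1 : ((c + t + 1 : ℕ) : ℝ) ≤ α := by exact_mod_cast hle
    have h2 := pow_sub_le_sub_pow (Nat.cast_nonneg (c + t + 1)) h1 t
    have h3 : ((α : ℝ) - (c + t + 1 : ℕ)) ^ (t + 1) ≤ ((t + 1)! : ℝ) * (k.choose (t + 1) : ℝ) := by
      have : (α - (c + t + 1)) ^ (t + 1) ≤ (t + 1)! * k.choose (t + 1) := by
        rw [← Nat.descFactorial_eq_factorial_mul_choose]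
        exact (Nat.pow_le_pow_left (by omega) _).trans (Nat.pow_sub_le_descFactorial k (t + 1))
      rw [← Nat.cast_sub hle]
      exact_mod_cast this
    have h4 : ((t : ℝ) + 1) ≤ ((t + 1)! : ℝ) := by exact_mod_cast Nat.self_le_factorial (t + 1)
    have h5 : ((t : ℝ) + 1) * ((c + t + 1 : ℕ) : ℝ) * (α : ℝ) ^ t ≤
        ((t + 1)! : ℝ) * (((c + t + 1 : ℕ) : ℝ) * (α : ℝ) ^ t) := by
      rw [mul_assoc]; gcongr
    have h6 : (α : ℝ) ^ (t + 1) ≤ ((t + 1)! : ℝ) *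
        ((k.choose (t + 1) : ℝ) + ((c + t + 1 : ℕ) : ℝ) * (α : ℝ) ^ t) := by
      rw [mul_add]; linarith
    have h7 := (div_le_iff₀' (by linarith : (0 : ℝ) < ((t + 1)! : ℝ))).2 h6
    rw [one_div_mul_eq_div]
    linarith

end EvenDS

/-! ### The main theorem -/

theorem mainTheorem9 (s : ℕ) (hs : Even s) (h4 : 4 ≤ s) :
    -- the block structure of the sequences, and the absence of long alternations
    (∀ k m : ℕ, 1 ≤ m →
      EvenDS.blocks s k m ≠ [] ∧
      (∀ B ∈ EvenDS.blocks s k m, B.length = m ∧ B.Nodup) ∧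
      EvenDS.AvoidsAlternation (s + 2) (EvenDS.seq s k m) ∧
      (∀ B ∈ EvenDS.blocks s k m, ∀ B' ∈ EvenDS.blocks s k m, ∀ a : ℕ,
        a ∈ B → a ∈ B' → B.idxOf a = B'.idxOf a) ∧
      (EvenDS.blocks s k m).Pairwise (fun B B' => ∀ a b : ℕ,
        a ∈ B → b ∈ B → a ∈ B' → b ∈ B' → a = b)) ∧
    -- they are Davenport–Schinzel sequences of order `s`
    (∀ k m : ℕ, 2 ≤ m → EvenDS.IsDavenportSchinzel s (EvenDS.seq s k m)) ∧
    -- all symbols have the same multiplicity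
    (∀ k m : ℕ, 1 ≤ m → ∀ a ∈ EvenDS.seq s k m,
      (EvenDS.seq s k m).count a = EvenDS.mu s k) ∧
    (∀ k : ℕ, EvenDS.mu s k = 2 ^ k.choose (s / 2 - 1)) ∧
    -- the bound attained by the sequences `S^s_k(2)`, and the resulting bound for `λ_s(n)`
    (∃ C : ℝ,
      (∀ k n : ℕ, EvenDS.numSymbols (EvenDS.seq s k 2) = n →
        (n : ℝ) * (2 : ℝ) ^ ((1 / ((s / 2 - 1)! : ℝ)) * (EvenDS.invAck n : ℝ) ^ (s / 2 - 1)
            - C * (EvenDS.invAck n : ℝ) ^ (s / 2 - 1 - 1))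
          ≤ ((EvenDS.seq s k 2).length : ℝ)) ∧
      (∀ n : ℕ, 1 ≤ n →
        (n : ℝ) * (2 : ℝ) ^ ((1 / ((s / 2 - 1)! : ℝ)) * (EvenDS.invAck n : ℝ) ^ (s / 2 - 1)
            - C * (EvenDS.invAck n : ℝ) ^ (s / 2 - 1 - 1))
          ≤ (EvenDS.lambda s n : ℝ))) := by
  have hmu : ∀ k, EvenDS.mu s k = 2 ^ k.choose (s / 2 - 1) := by
    intro k
    obtain ⟨t, ht⟩ : ∃ t, s = 2 * (t + 1) := by
      rw [Nat.even_iff] at hs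
      exact ⟨s / 2 - 1, by omega⟩
    rw [ht, EvenDS.mu_eq]
    congr 2
    omega
  refine ⟨fun k m hm => ?_, fun k m hm => ?_, fun k m hm a ha => ?_, hmu, ?_⟩
  · have h := EvenDS.isPositional_blocks hs h4 k hm
    refine ⟨h.ne_nil, h.length_nodup, EvenDS.avoidsAlternation_iff.2 h.altLength_le, ?_, h.pairwise⟩
    obtain ⟨pos, hpos⟩ := h.position
    exact fun B hB B' hB' a ha ha' => (hpos B hB a ha).trans (hpos B' hB' a ha').symm
  · exact (EvenDS.isPositional_blocks hs h4 k (by omega)).isDavenportSchinzel hm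
  · exact (EvenDS.isPositional_blocks hs h4 k hm).count_eq a ha
  · obtain ⟨t, ht⟩ : ∃ t, s / 2 - 1 = t + 1 := ⟨s / 2 - 2, by omega⟩
    have hmu' : ∀ k, (EvenDS.mu s k : ℝ) = (2 : ℝ) ^ ((k.choose (t + 1) : ℕ) : ℝ) := by
      intro k
      rw [hmu, ht, Real.rpow_natCast]
      push_cast
      rfl
    have key : ∀ k n : ℕ, EvenDS.invAck n ≤ k + 6 →
        (2 : ℝ) ^ ((1 / ((t + 1)! : ℝ)) * (EvenDS.invAck n : ℝ) ^ (t + 1)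
            - ((6 + t + 2 : ℕ) : ℝ) * (EvenDS.invAck n : ℝ) ^ t) ≤ (EvenDS.mu s k : ℝ) / 2 := by
      intro k n h
      rw [hmu' k, ← Real.rpow_sub_one (by norm_num)]
      exact Real.rpow_le_rpow_of_exponent_le (by norm_num)
        (EvenDS.exponent_le_choose (EvenDS.one_le_invAck n) h)
    rw [ht, Nat.add_sub_cancel]
    -- The 6 is the offset in α(n) ≤ k+6, which serves both bounds.
    refine ⟨((6 + t + 2 : ℕ) : ℝ), ?_, ?_⟩
    · rintro k n rfl
      have hα : EvenDS.invAck (EvenDS.numSymbols (EvenDS.seq s k 2)) ≤ k + 6 :=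
        (EvenDS.invAck_le (by omega) (EvenDS.numSymbols_seq_le hs h4 k)).trans (by omega)
      refine (mul_le_mul_of_nonneg_left (key k _ hα) (Nat.cast_nonneg _)).trans ?_
      rw [← EvenDS.numSymbols_seq_mul hs h4 k, Nat.cast_mul]
      gcongr
      exact half_le_self (Nat.cast_nonneg _)
    · intro n _
      obtain ⟨k, hα, hk⟩ := EvenDS.exists_mul_mu_le_two_mul_lambda hs h4 n
      refine (mul_le_mul_of_nonneg_left (key k _ hα) (Nat.cast_nonneg _)).trans ?_
      have : (n : ℝ) * EvenDS.mu s k ≤ 2 * EvenDS.lambda s n := by exact_mod_cast hk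
      linarith
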